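/- Let $k\ge 1$ and let $(\overline M,g)$ be a closed (compact, without boundary, smooth, Hausdorff) Riemannian manifold of dimension $2k-1$, with Riemann curvature tensor $R$, and let $\mathrm{Isom}(\overline M,g)$ be the group of diffeomorphisms of $\overline M$ that preserve $g$. Let $L\overline M$ be the space of smooth loops $\gamma:S^1\to\overline M$; a tangent vector $X\in T_\gamma L\overline M$ is a smooth vector field along $\gamma$. For $m\in\overline M$ and $w,X_1,\dots,X_{2k-1}\in T_m\overline M$ set $$K_m(w;X_1,\dots,X_{2k-1})=\sum_{\sigma\in S_{2k-1}}\mathrm{sgn}(\sigma)\,\mathrm{tr}\Bigl(\bigl[v\mapsto R(X_{\sigma(1)},v)w\bigr]\circ R(X_{\sigma(2)},X_{\sigma(3)})\circ\cdots\circ R(X_{\sigma(2k-2)},X_{\sigma(2k-1)})\Bigr),$$ where $R(u,v)$ is regarded as an endomorphism of $T_m\overline M$ and the trace is taken on $T_m\overline M$. The Wodzicki–Chern–Simons form on $L\overline M$ is $$CS^W_{2k-1}(\gamma)(X_1,\dots,X_{2k-1})=\int_0^{2\pi}K_{\gamma(\theta)}\bigl(\dot\gamma(\theta);X_1(\theta),\dots,X_{2k-1}(\theta)\bigr)\,d\theta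 .$$ Let $a_0,a_1:S^1\times\overline M\to\overline M$ be smooth $S^1$-actions on $\overline M$ with $a_i(\theta,\cdot)\in\mathrm{Isom}(\overline M,g)$ for all $\theta\in S^1$. Let $F:[0,1]\times S^1\times\overline M\to\overline M$ be a smooth map with $F(0,\cdot,\cdot)=a_0$ and $F(1,\cdot,\cdot)=a_1$, such that $F(x^0,\theta,\cdot)\in\mathrm{Isom}(\overline M,g)$ for all $(x^0,\theta)\in[0,1]\times S^1$. Define $F^L:[0,1]\times\overline M\to L\overline M$ by $F^L(x^0,m)(\theta)=F(x^0,\theta,m)$, with differential $(F^L_*V)(\theta)=d\bigl(F(\cdot,\theta,\cdot)\bigr)_{(x^0,m)}(V)$ for $V\in T_{(x^0,m)}([0,1]\times\overline M)$. Then the pullback $$(F^{L,*}CS^W_{2k-1})_{p}(V_1,\dots,V_{2k-1})=CS^W_{2k-1}(F^L(p))(F^L_*V_1,\dots,F^L_*V_{2k-1})$$ is a smooth differential $(2k-1)$-form on $[0,1]\times\overline M$, and it is closed: $d_{[0,1]\times\overline M}\,F^{L,*}CS^W_{2k-1}=0$. -/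

import Mathlib

open scoped Manifold ContDiff Bundle

noncomputable section

namespace LoopCS

/-! ### Curvature of a metric on an open set of a vector space -/

section Chart

variable {E : Type*} [NormedAddCommGroup E] [NormedSpace ℝ E]

set_option synthInstance.maxHeartbeats 400000

/-- The Christoffel symbols `Γ_y(u, v)` of a field `G` of nondegenerate symmetric bilinear forms
on `E`, that is, `Γ(u, v) = 1/2 G⁻¹ (∂_u G (v, ·) + ∂_v G (u, ·) - ∂_· G (u, v))`. -/
def christoffel (G : E → E →L[ℝ] E →L[ℝ] ℝ) (y : E) : E →L[ℝ] E →L[ℝ] E :=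
  let P : E →L[ℝ] E →L[ℝ] E →L[ℝ] ℝ := fderiv ℝ G y
  let A : (E →L[ℝ] E →L[ℝ] ℝ) →L[ℝ] (E →L[ℝ] E) :=
    ContinuousLinearMap.compL ℝ E (E →L[ℝ] ℝ) E (G y).inverse
  let T : (E →L[ℝ] E →L[ℝ] ℝ) →L[ℝ] (E →L[ℝ] E →L[ℝ] ℝ) :=
    (ContinuousLinearMap.flipₗᵢ ℝ E E ℝ : (E →L[ℝ] E →L[ℝ] ℝ) ≃L[ℝ] (E →L[ℝ] E →L[ℝ] ℝ))
  (1 / 2 : ℝ) • (A.comp P + A.comp P.flip - A.comp (T.comp P.flip))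

/-- The defining property of the Christoffel symbols, which shows that the formula above is the
usual one. -/
theorem christoffel_spec (G : E → E →L[ℝ] E →L[ℝ] ℝ) (y u v w : E) (h : (G y).IsInvertible) :
    G y (christoffel G y u v) w =
      (1 / 2 : ℝ) * (fderiv ℝ G y u v w + fderiv ℝ G y v u w - fderiv ℝ G y w u v) := by
  have hinv : ∀ f, G y ((G y).inverse f) = f := by
    obtain ⟨e, he⟩ := h
    intro f
    rw [← he, ContinuousLinearMap.inverse_equiv]
    simp
  simp [christoffel, hinv]

/-- The curvature endomorphism
`R_y(u, v) = ∂_u Γ(v) - ∂_v Γ(u) + Γ(u) ∘ Γ(v) - Γ(v) ∘ Γ(u)`, so that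
`R_y(e_i, e_j) e_l = R_{ijl}{}^m e_m` in terms of the components of the curvature tensor. -/
def chartCurvature (G : E → E →L[ℝ] E →L[ℝ] ℝ) (y u v : E) : E →L[ℝ] E :=
  fderiv ℝ (christoffel G) y u v - fderiv ℝ (christoffel G) y v u
    + (christoffel G y u).comp (christoffel G y v) - (christoffel G y v).comp (christoffel G y u)

theorem chartCurvature_apply (G : E → E →L[ℝ] E →L[ℝ] ℝ) (y u v w : E) :
    chartCurvature G y u v w =
      fderiv ℝ (christoffel G) y u v w - fderiv ℝ (christoffel G) y v u w
        + christoffel G y u (christoffel G y v w) - christoffel G y v (christoffel G y u w) := rfl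

theorem chartCurvature_add_right (G : E → E →L[ℝ] E →L[ℝ] ℝ) (y u v v' w : E) :
    chartCurvature G y u (v + v') w = chartCurvature G y u v w + chartCurvature G y u v' w := by
  rw [chartCurvature_apply, chartCurvature_apply, chartCurvature_apply]
  generalize fderiv ℝ (christoffel G) y = P
  generalize christoffel G y = C
  rw [(P u).map_add, P.map_add, C.map_add, add_apply, add_apply, add_apply, add_apply,
    add_apply,
    (C u).map_add]
  abel

theorem chartCurvature_smul_right (G : E → E →L[ℝ] E →L[ℝ] ℝ) (y u v w : E) (c : ℝ) :
    chartCurvature G y u (c • v) w = c • chartCurvature G y u v w := by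
  rw [chartCurvature_apply, chartCurvature_apply]
  generalize fderiv ℝ (christoffel G) y = P
  generalize christoffel G y = C
  rw [(P u).map_smul, P.map_smul, C.map_smul, smul_apply, smul_apply, smul_apply, smul_apply,
    smul_apply,
    (C u).map_smul, smul_sub, smul_add, smul_sub]

end Chart

/-! ### Curvature and isometries of a Riemannian manifold -/

/-- `ℝⁿ` with its Euclidean structure. -/
abbrev Euc (n : ℕ) : Type := EuclideanSpace ℝ (Fin n)

section Manifold

variable {n : ℕ} {M : Type*} [TopologicalSpace M] [ChartedSpace (Euc n) M]
  [IsManifold (𝓡 n) ∞ M]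

/-- A smooth Riemannian metric on the manifold `M`. -/
abbrev RiemMetric (n : ℕ) (M : Type*) [TopologicalSpace M] [ChartedSpace (Euc n) M]
    [IsManifold (𝓡 n) ∞ M] : Type _ :=
  Bundle.ContMDiffRiemannianMetric (𝓡 n) ∞ (Euc n) (fun m : M => TangentSpace (𝓡 n) m)

/-- The metric `g` read in the chart around `m`: the field `y ↦ (g_{ij}(y))` of bilinear forms. -/
def metricInChart (g : RiemMetric n M) (m : M) (y : Euc n) : Euc n →L[ℝ] Euc n →L[ℝ] ℝ :=
  let B : Euc n →L[ℝ] Euc n →L[ℝ] ℝ := g.inner ((extChartAt (𝓡 n) m).symm y)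
  let D : Euc n →L[ℝ] Euc n := mfderiv 𝓘(ℝ, Euc n) (𝓡 n) (extChartAt (𝓡 n) m).symm y
  B.bilinearComp D D

/-- The differential at `m` of the chart around `m`, an isomorphism `T_m M → ℝⁿ`. -/
def chartDiff (n : ℕ) {M : Type*} [TopologicalSpace M] [ChartedSpace (Euc n) M] (m : M) :
    TangentSpace (𝓡 n) m →L[ℝ] Euc n :=
  mfderiv (𝓡 n) 𝓘(ℝ, Euc n) (extChartAt (𝓡 n) m) m

/-- The Riemann curvature operator `R(u, v) : T_m M → T_m M` of `g` at `m`, computed in the chart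
around `m`. -/
def curvature (g : RiemMetric n M) (m : M) (u v : TangentSpace (𝓡 n) m) :
    TangentSpace (𝓡 n) m →L[ℝ] TangentSpace (𝓡 n) m :=
  (chartDiff n m).inverse.comp
    ((chartCurvature (metricInChart g m) (extChartAt (𝓡 n) m m)
      (chartDiff n m u) (chartDiff n m v)).comp (chartDiff n m))

theorem curvature_apply (g : RiemMetric n M) (m : M) (u v w : TangentSpace (𝓡 n) m) :
    curvature g m u v w = (chartDiff n m).inverse
      (chartCurvature (metricInChart g m) (extChartAt (𝓡 n) m m)
        (chartDiff n m u) (chartDiff n m v) (chartDiff n m w)) := rfl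

/-- The endomorphism `v ↦ R(u, v) w` of `T_m M`. -/
def curvatureMiddle (g : RiemMetric n M) (m : M) (u w : TangentSpace (𝓡 n) m) :
    TangentSpace (𝓡 n) m →ₗ[ℝ] TangentSpace (𝓡 n) m where
  toFun v := curvature g m u v w
  map_add' v v' := by
    simp only [curvature_apply, map_add, chartCurvature_add_right]
  map_smul' c v := by
    simp only [curvature_apply, map_smul, chartCurvature_smul_right, RingHom.id_apply]

/-- `f` is an isometry of the Riemannian manifold `(M, g)`: a diffeomorphism with `f^* g = g`. -/
def IsRiemannianIsometry (g : RiemMetric n M) (f : M → M) : Prop :=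
  (∃ Φ : M ≃ₘ⟮𝓡 n, 𝓡 n⟯ M, ⇑Φ = f) ∧
    ∀ (m : M) (u v : TangentSpace (𝓡 n) m),
      g.inner (f m) (mfderiv (𝓡 n) (𝓡 n) f m u) (mfderiv (𝓡 n) (𝓡 n) f m v) = g.inner m u v

/-- `a : S¹ × M → M` is a smooth action of the circle group on `(M, g)` by isometries. -/
def IsIsometricCircleAction (g : RiemMetric n M) (a : Circle → M → M) : Prop :=
  ContMDiff ((𝓡 1).prod (𝓡 n)) (𝓡 n) ∞ (fun p : Circle × M => a p.1 p.2) ∧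
    (∀ m, a 1 m = m) ∧ (∀ θ θ' m, a (θ * θ') m = a θ (a θ' m)) ∧
    ∀ θ, IsRiemannianIsometry g (a θ)

/-! ### The loop space and its tangent spaces -/

/-- The space `LM` of smooth loops in `M`. -/
abbrev LoopSpace (n : ℕ) (M : Type*) [TopologicalSpace M] [ChartedSpace (Euc n) M] : Type _ :=
  C^∞⟮𝓡 1, Circle; 𝓡 n, M⟯

/-- The tangent space `T_γ LM`: smooth vector fields along the loop `γ`. -/
structure LoopTangent (γ : LoopSpace n M) where
  /-- the value of the vector field at a point of the circle -/
  toFun : ∀ z : Circle, TangentSpace (𝓡 n) (γ z)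
  smooth : ContMDiff (𝓡 1) (𝓡 n).tangent ∞
    (fun z => (⟨γ z, toFun z⟩ : TangentBundle (𝓡 n) M))

/-- The velocity `γ̇(θ)` of the `2π`-periodic curve `θ ↦ γ(e^{iθ})`. -/
def velocity (γ : LoopSpace n M) (θ : ℝ) : TangentSpace (𝓡 n) (γ (Circle.exp θ)) :=
  mfderiv 𝓘(ℝ, ℝ) (𝓡 n) (fun s : ℝ => γ (Circle.exp s)) θ (1 : ℝ)

end Manifold

/-! ### The Wodzicki-Chern-Simons form -/

section CS

variable {k : ℕ} [NeZero k] {M : Type*} [TopologicalSpace M] [ChartedSpace (Euc (2 * k - 1)) M]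
  [IsManifold (𝓡 (2 * k - 1)) ∞ M]

/-- The tensor `K` on a Riemannian `(2k-1)`-manifold, evaluated on `w, X_1, …, X_{2k-1}`
(numbered from `0` in the code):
`∑_σ sgn(σ) tr (R(X_{σ(1)}, ·) w ∘ R(X_{σ(2)}, X_{σ(3)}) ∘ ⋯ ∘ R(X_{σ(2k-2)}, X_{σ(2k-1)}))`. -/
def kTensor (g : RiemMetric (2 * k - 1) M) (m : M) (w : TangentSpace (𝓡 (2 * k - 1)) m)
    (X : Fin (2 * k - 1) → TangentSpace (𝓡 (2 * k - 1)) m) : ℝ :=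
  ∑ σ : Equiv.Perm (Fin (2 * k - 1)), ((Equiv.Perm.sign σ : ℤ) : ℝ) *
    LinearMap.trace ℝ (TangentSpace (𝓡 (2 * k - 1)) m)
      (curvatureMiddle g m
          (X (σ ⟨0, by have := NeZero.pos k; omega⟩)) w *
        (List.ofFn fun i : Fin (k - 1) =>
          ((curvature g m
            (X (σ ⟨2 * i + 1, by omega⟩))
            (X (σ ⟨2 * i + 2, by omega⟩))).toLinearMap :
              Module.End ℝ (TangentSpace (𝓡 (2 * k - 1)) m))).prod)

/-- The Wodzicki-Chern-Simons `(2k-1)`-form on the loop space of a Riemannian `(2k-1)`-manifold: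
`CS^W(γ)(X_1, …, X_{2k-1}) = ∫₀^{2π} K_{γ(θ)}(γ̇(θ), X_1(θ), …, X_{2k-1}(θ)) dθ`. -/
def wodzickiCS (g : RiemMetric (2 * k - 1) M) (γ : LoopSpace (2 * k - 1) M)
    (X : Fin (2 * k - 1) → LoopTangent γ) : ℝ :=
  ∫ θ in (0 : ℝ)..(2 * Real.pi),
    kTensor g (γ (Circle.exp θ)) (velocity γ θ) (fun i => (X i).toFun (Circle.exp θ))

end CS

/-! ### Homotopies of circle families of maps and the induced maps into the loop space -/

section Homotopy

variable {n : ℕ} {M : Type*} [TopologicalSpace M] [ChartedSpace (Euc n) M]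

/-- The model with corners of `[0,1] × M`. -/
abbrev cylModel (n : ℕ) : ModelWithCorners ℝ (Euc 1 × Euc n) (ModelProd (EuclideanHalfSpace 1) (Euc n)) :=
  (𝓡∂ 1).prod (𝓡 n)

/-- Smoothness of a map `F : [0,1] × S¹ × M → M`. -/
def IsSmoothHomotopy (n : ℕ) {M : Type*} [TopologicalSpace M] [ChartedSpace (Euc n) M]
    (F : unitInterval × Circle × M → M) : Prop :=
  ContMDiff ((𝓡∂ 1).prod ((𝓡 1).prod (𝓡 n))) (𝓡 n) ∞ F

/-- The map `F^L : [0,1] × M → LM`, `F^L(t, m)(θ) = F(t, θ, m)`. -/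
def loopMap {F : unitInterval × Circle × M → M} (hF : IsSmoothHomotopy n F)
    (p : unitInterval × M) : LoopSpace n M :=
  ⟨fun z => F (p.1, z, p.2),
    hF.comp (contMDiff_const.prodMk (contMDiff_id.prodMk contMDiff_const))⟩

variable [IsManifold (𝓡 n) ∞ M]

theorem loopMap_deriv_smooth {F : unitInterval × Circle × M → M} (hF : IsSmoothHomotopy n F)
    (p : unitInterval × M) (v : TangentSpace (cylModel n) p) :
    ContMDiff (𝓡 1) (𝓡 n).tangent ∞ (fun z : Circle =>
      (⟨loopMap hF p z, mfderiv (cylModel n) (𝓡 n) (fun q => loopMap hF q z) p v⟩ :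
        TangentBundle (𝓡 n) M)) := by
  have h1 : ContMDiff (𝓡 1) (𝓡 1).tangent ∞
      (fun z : Circle => (⟨z, 0⟩ : TangentBundle (𝓡 1) Circle)) :=
    Bundle.contMDiff_zeroSection ℝ (TangentSpace (𝓡 1) : Circle → Type)
  have h2 := (contMDiff_equivTangentBundleProd_symm (I := 𝓡 1) (M := Circle) (I' := 𝓡 n)
    (M' := M) (n := ∞)).comp (h1.prodMk
      (contMDiff_const (c := (⟨p.2, v.2⟩ : TangentBundle (𝓡 n) M))))
  have h3 := (contMDiff_equivTangentBundleProd_symm (I := 𝓡∂ 1) (M := unitInterval)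
    (I' := (𝓡 1).prod (𝓡 n)) (M' := Circle × M) (n := ∞)).comp
      ((contMDiff_const (c := (⟨p.1, v.1⟩ : TangentBundle (𝓡∂ 1) unitInterval))).prodMk h2)
  have h4 := (hF.contMDiff_tangentMap (m := ∞) (by simp)).comp h3
  refine h4.congr fun z => ?_
  have hi : HasMFDerivAt (cylModel n) ((𝓡∂ 1).prod ((𝓡 1).prod (𝓡 n)))
      (fun q : unitInterval × M => (q.1, z, q.2)) p _ :=
    (hasMFDerivAt_fst (x := p)).prodMk
      ((hasMFDerivAt_const z p).prodMk (hasMFDerivAt_snd (x := p)))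
  have hd := ((hF.mdifferentiable (by simp) (p.1, z, p.2)).hasMFDerivAt.comp p hi).mfderiv
  simp only [tangentMap, Function.comp]
  congr 1
  exact congrArg (fun L => L v) hd


/-- The differential `F^L_* : T_p([0,1] × M) → T_{F^L(p)} LM`; its value at `z ∈ S¹` is the
derivative of `q ↦ F^L(q)(z)`. -/
def loopMapDeriv {F : unitInterval × Circle × M → M} (hF : IsSmoothHomotopy n F)
    (p : unitInterval × M) (v : TangentSpace (cylModel n) p) : LoopTangent (loopMap hF p) where
  toFun z := mfderiv (cylModel n) (𝓡 n) (fun q => loopMap hF q z) p v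
  smooth := loopMap_deriv_smooth hF p v

end Homotopy

/-! ### Differential forms on manifolds (possibly with boundary) -/

section Forms

variable {E : Type*} [NormedAddCommGroup E] [NormedSpace ℝ E] {H : Type*} [TopologicalSpace H]
  (J : ModelWithCorners ℝ E H) {N : Type*} [TopologicalSpace N] [ChartedSpace H N] {d : ℕ}

/-- The alternating form field `η` read in the chart around `p`. -/
def formInChart (η : ∀ q : N, TangentSpace J q [⋀^Fin d]→L[ℝ] ℝ) (p : N) (y : E) :
    E [⋀^Fin d]→L[ℝ] ℝ :=
  let A : E [⋀^Fin d]→L[ℝ] ℝ := η ((extChartAt J p).symm y)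
  let D : E →L[ℝ] E := mfderivWithin 𝓘(ℝ, E) J (extChartAt J p).symm (Set.range J) y
  A.compContinuousLinearMap D

/-- `η` is a smooth differential form: it is smooth in every chart. -/
def IsSmoothForm (η : ∀ q : N, TangentSpace J q [⋀^Fin d]→L[ℝ] ℝ) : Prop :=
  ∀ p : N, ContDiffOn ℝ ∞ (formInChart J η p) (extChartAt J p).target

/-- The exterior derivative `dη` at `p`, computed in the chart around `p`. -/
def exteriorDerivative (η : ∀ q : N, TangentSpace J q [⋀^Fin d]→L[ℝ] ℝ) (p : N) :
    TangentSpace J p [⋀^Fin (d + 1)]→L[ℝ] ℝ :=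
  (extDerivWithin (formInChart J η p) (Set.range J) (extChartAt J p p)).compContinuousLinearMap
    (mfderiv J 𝓘(ℝ, E) (extChartAt J p) p : TangentSpace J p →L[ℝ] E)

end Forms

end LoopCS

end

/-! Put n = 2k - 1. The pullback has degree n on a manifold of dimension n + 1, so its exterior
derivative is a top-degree form and is determined by its values on (∂₀, e₁, …, eₙ), with ∂₀ along
[0,1] and the eᵢ tangent to M. For fixed θ, the exterior derivative of the integrand K(∂F/∂θ; F_*·,
…, F_*·) takes on these vectors the value φ'(θ), where φ(θ) = K(∂F/∂x⁰; F_*e₁, …, F_*eₙ).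
Integration over a period gives φ(2π) - φ(0) = 0.

The identity with φ' comes from the invariance of K under isometries. Let D be the differential at m
of the slice F(x⁰, θ, ·), and let Y(θ) in T_mM solve D Y = ∂F/∂x⁰. Invariance gives φ(θ) = K_m(Y(θ);
e), hence φ' = K_m(Y'; e). On the other side, write ∂₀ = ξ + Y, where ξ = ∂₀ - Y is killed by the
differential of F(·, θ, ·). The Y part contributes nothing, being an alternating form on n + 1
vectors of T_mM. For the ξ part, the integrand is the pullback under (F, ∂F/∂θ) of the n-form (y, w)
↦ K_y(w; ·) on TM. The vector ξ goes to a vertical vector, equal to D Y', and since K is linear in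
w, contracting the exterior derivative of that form with a vertical vector c replaces w by c. The
result is K(D Y'; D e) = K_m(Y'; e). The curvature enters only through smoothness, multilinearity
and naturality.

Invariance of K is `kTensor_eq_curvSum_chart`, resting on `chartCurvature_pullback` and
`curvTrace_equiv`. The pointwise identity is `hasDerivAt_transgression`, built on
`extDerivWithin_apply_cons_of_map_eq_zero`. Smoothness up to the boundary is
`contDiffOn_intervalIntegral`, and `extDerivWithin_intervalIntegral_apply_eq_zero` integrates the
identity. -/

namespace LoopCS

/-! ### Smoothness tests in finite dimension -/

section Smoothness

variable {E F : Type*} [NormedAddCommGroup E] [NormedSpace ℝ E] [FiniteDimensional ℝ E]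
  [NormedAddCommGroup F] [NormedSpace ℝ F] {s : Set F} {x : F} {r : WithTop ℕ∞}

/-- Smoothness of a map into a finite-dimensional space can be tested on a separating family of
linear functionals. -/
theorem contDiffWithinAt_of_separating {V : Type*} [NormedAddCommGroup V] [NormedSpace ℝ V]
    [FiniteDimensional ℝ V] {f : F → V} {ι : Type*} (L : ι → V →ₗ[ℝ] ℝ)
    (hL : ∀ v, (∀ i, L i v = 0) → v = 0) (hf : ∀ i, ContDiffWithinAt ℝ r (fun y => L i (f y)) s x) :
    ContDiffWithinAt ℝ r f s x := by
  -- In finite dimension a subspace of the dual is the annihilator of its common kernel. Here that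
  -- kernel is zero, so the functionals span the dual.
  have htop : Submodule.span ℝ (Set.range L) = ⊤ := by
    have hbot : (Submodule.span ℝ (Set.range L)).dualCoannihilator = ⊥ := by
      refine (Submodule.eq_bot_iff _).2 fun v hv => hL v fun i => ?_
      exact (Submodule.mem_dualCoannihilator _).1 hv _ (Submodule.subset_span ⟨i, rfl⟩)
    rw [← Subspace.dualCoannihilator_dualAnnihilator_eq (W := Submodule.span ℝ (Set.range L)),
      hbot, Submodule.dualAnnihilator_bot]
  have hall : ∀ l : Module.Dual ℝ V, ContDiffWithinAt ℝ r (fun y => l (f y)) s x := by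
    intro l
    have hl : l ∈ Submodule.span ℝ (Set.range L) := htop ▸ Submodule.mem_top
    induction hl using Submodule.span_induction with
    | mem l hl => obtain ⟨i, rfl⟩ := hl; exact hf i
    | zero => exact contDiffWithinAt_const
    | add l l' _ _ h h' => exact h.add h'
    | smul c l _ h => exact h.const_smul c
  let b := Module.finBasis ℝ V
  have hsum : f = fun y => ∑ i, b.coord i (f y) • b i := by
    ext1 y
    exact (b.sum_repr (f y)).symm
  rw [hsum]
  exact ContDiffWithinAt.sum fun i _ => (hall (b.coord i)).smul contDiffWithinAt_const

theorem contDiffWithinAt_clm_of_apply {G : Type*} [NormedAddCommGroup G] [NormedSpace ℝ G]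
    {f : F → E →L[ℝ] G} (hf : ∀ v, ContDiffWithinAt ℝ r (fun y => f y v) s x) :
    ContDiffWithinAt ℝ r f s x := by
  let b := Module.finBasis ℝ E
  have hsum : f = fun y =>
      ∑ i, ((b.coord i).toContinuousLinearMap).smulRight (f y (b i)) := by
    ext y v
    conv_lhs => rw [← b.sum_repr v, map_sum]
    simp
  rw [hsum]
  refine ContDiffWithinAt.sum fun i _ => ?_
  exact (ContinuousLinearMap.smulRightL ℝ E G (b.coord i).toContinuousLinearMap).contDiff
    |>.comp_contDiffWithinAt (hf (b i))

theorem contDiffWithinAt_list_prod_ofFn {A : Type*} [NormedRing A] [NormedAlgebra ℝ A] {m : ℕ}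
    (f : Fin m → F → A) (hf : ∀ i, ContDiffWithinAt ℝ r (f i) s x) :
    ContDiffWithinAt ℝ r (fun y => (List.ofFn fun i => f i y).prod) s x := by
  induction m with
  | zero => simpa using contDiffWithinAt_const
  | succ m ih =>
    simp only [List.ofFn_succ, List.prod_cons]
    exact (hf 0).mul (ih _ fun i => hf i.succ)

/-- The values of `C` lie in purely algebraic spaces of linear maps, so its smoothness is assumed
only on fixed vectors. In a basis the expression is a polynomial in coordinates with smooth
coefficients. -/
theorem contDiffWithinAt_trilinear {C : F → E →ₗ[ℝ] E →ₗ[ℝ] Module.End ℝ E}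
    (hC : ∀ u v w, ContDiffWithinAt ℝ r (fun y => C y u v w) s x) {u v w : F → E}
    (hu : ContDiffWithinAt ℝ r u s x) (hv : ContDiffWithinAt ℝ r v s x)
    (hw : ContDiffWithinAt ℝ r w s x) :
    ContDiffWithinAt ℝ r (fun y => C y (u y) (v y) (w y)) s x := by
  let b := Module.finBasis ℝ E
  have hb : ∀ i {f : F → E}, ContDiffWithinAt ℝ r f s x →
      ContDiffWithinAt ℝ r (fun y => b.repr (f y) i) s x := fun i f hf =>
    (b.coord i).toContinuousLinearMap.contDiff.comp_contDiffWithinAt hf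
  have key : ∀ y, C y (u y) (v y) (w y) =
      ∑ i, ∑ j, ∑ l, (b.repr (u y) i * b.repr (v y) j * b.repr (w y) l) •
        C y (b i) (b j) (b l) := by
    intro y
    conv_lhs => rw [← b.sum_repr (u y), ← b.sum_repr (v y), ← b.sum_repr (w y)]
    rw [map_sum (C y), LinearMap.sum_apply, LinearMap.sum_apply]
    refine Finset.sum_congr rfl fun i _ => ?_
    rw [map_sum (C y _), LinearMap.sum_apply]
    refine Finset.sum_congr rfl fun j _ => ?_
    rw [map_sum (C y _ _)]
    refine Finset.sum_congr rfl fun l _ => ?_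
    simp only [map_smul, LinearMap.smul_apply, smul_smul]
    congr 1
    ring
  simp only [key]
  exact ContDiffWithinAt.sum fun i _ => ContDiffWithinAt.sum fun j _ => ContDiffWithinAt.sum
    fun l _ => (((hb i hu).mul (hb j hv)).mul (hb l hw)).smul (hC _ _ _)

end Smoothness

/-! ### The trace polynomial in an abstract curvature tensor -/

section Algebra

variable {E : Type*} [AddCommGroup E] [Module ℝ E] {k : ℕ} [NeZero k]

/-- The trace of `C(X₀, ·) w ∘ C(X₁, X₂) ∘ ⋯ ∘ C(X_{2k-3}, X_{2k-2})`. -/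
noncomputable def curvTrace (k : ℕ) [NeZero k] (C : E →ₗ[ℝ] E →ₗ[ℝ] Module.End ℝ E) (w : E)
    (X : Fin (2 * k - 1) → E) : ℝ :=
  LinearMap.trace ℝ E ((C (X ⟨0, by have := NeZero.pos k; omega⟩)).flip w *
    (List.ofFn fun i : Fin (k - 1) =>
      C (X ⟨2 * i + 1, by omega⟩) (X ⟨2 * i + 2, by omega⟩)).prod)

theorem list_prod_ofFn_update {A : Type*} [Ring A] [Algebra ℝ A] {m : ℕ} (f : Fin m → A)
    (i : Fin m) (a : A) :
    (List.ofFn (Function.update f i a)).prod =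
      (MultilinearMap.mkPiAlgebraFin ℝ m A).toLinearMap f i a := by
  simp [MultilinearMap.toLinearMap]

/-- `curvTrace` is linear in each of its last arguments. -/
theorem exists_curvTrace_update (C : E →ₗ[ℝ] E →ₗ[ℝ] Module.End ℝ E) (w : E)
    (X : Fin (2 * k - 1) → E) (j : Fin (2 * k - 1)) :
    ∃ T : E →ₗ[ℝ] ℝ, ∀ x, curvTrace k C w (Function.update X j x) = T x := by
  have hk := NeZero.pos k
  obtain ⟨j, hj⟩ := j
  let B : Fin (k - 1) → Module.End ℝ E := fun i =>
      C (X ⟨2 * i + 1, by omega⟩) (X ⟨2 * i + 2, by omega⟩)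
  rcases Nat.eq_zero_or_pos j with rfl | hpos
  · let D : E →ₗ[ℝ] Module.End ℝ E :=
      { toFun := fun x => (C x).flip w
        map_add' := fun _ _ => by ext; simp
        map_smul' := fun _ _ => by ext; simp }
    refine ⟨LinearMap.trace ℝ E ∘ₗ LinearMap.mulRight ℝ (List.ofFn B).prod ∘ₗ D, fun x => ?_⟩
    simp [curvTrace, B, D]
  · let A : Module.End ℝ E := (C (X ⟨0, by omega⟩)).flip w
    have h0 : (⟨0, by omega⟩ : Fin (2 * k - 1)) ≠ ⟨j, hj⟩ := by simp [Fin.ext_iff]; omega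
    -- A nonzero slot j is the first or second argument of the curvature factor of index (j - 1) /
    -- 2.
    obtain ⟨i, hi⟩ : ∃ i : Fin (k - 1), j = 2 * i + 1 ∨ j = 2 * i + 2 :=
      ⟨⟨(j - 1) / 2, by omega⟩, by dsimp only; omega⟩
    rcases hi with rfl | rfl
    · refine ⟨LinearMap.trace ℝ E ∘ₗ LinearMap.mulLeft ℝ A ∘ₗ
        (MultilinearMap.mkPiAlgebraFin ℝ _ _).toLinearMap B i ∘ₗ
          C.flip (X ⟨2 * i + 2, by omega⟩), fun x => ?_⟩
      simp only [curvTrace, LinearMap.comp_apply, ← list_prod_ofFn_update, LinearMap.mulLeft_apply,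
        Function.update_of_ne h0, A]
      congr 4
      ext1 l
      simp only [Function.update_apply, B, Fin.ext_iff]
      split_ifs <;> first | omega | simp_all
    · refine ⟨LinearMap.trace ℝ E ∘ₗ LinearMap.mulLeft ℝ A ∘ₗ
        (MultilinearMap.mkPiAlgebraFin ℝ _ _).toLinearMap B i ∘ₗ
          C (X ⟨2 * i + 1, by omega⟩), fun x => ?_⟩
      simp only [curvTrace, LinearMap.comp_apply, ← list_prod_ofFn_update, LinearMap.mulLeft_apply,
        Function.update_of_ne h0, A]
      congr 4
      ext1 l
      simp only [Function.update_apply, B, Fin.ext_iff]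
      split_ifs <;> first | omega | simp_all

/-- `curvTrace` as a multilinear map. -/
noncomputable def curvMultilinear (k : ℕ) [NeZero k] (C : E →ₗ[ℝ] E →ₗ[ℝ] Module.End ℝ E) (w : E) :
    MultilinearMap ℝ (fun _ : Fin (2 * k - 1) => E) ℝ where
  toFun := curvTrace k C w
  map_update_add' {inst} X j x y := by
    -- The field is stated for an arbitrary decidability instance, which is replaced by the standard
    -- one so that `Function.update` matches.
    obtain rfl : inst = instDecidableEqFin _ := Subsingleton.elim _ _
    obtain ⟨T, hT⟩ := exists_curvTrace_update C w X j
    simp only [hT, map_add]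
  map_update_smul' {inst} X j c x := by
    obtain rfl : inst = instDecidableEqFin _ := Subsingleton.elim _ _
    obtain ⟨T, hT⟩ := exists_curvTrace_update C w X j
    simp only [hT, map_smul]

/-- The antisymmetrization of `curvTrace` in its last arguments. -/
noncomputable def curvSum (k : ℕ) [NeZero k] (C : E →ₗ[ℝ] E →ₗ[ℝ] Module.End ℝ E) (w : E)
    (X : Fin (2 * k - 1) → E) : ℝ :=
  ∑ σ : Equiv.Perm (Fin (2 * k - 1)),
    ((Equiv.Perm.sign σ : ℤ) : ℝ) * curvTrace k C w (fun i => X (σ i))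

theorem curvMultilinear_alternatization_apply (C : E →ₗ[ℝ] E →ₗ[ℝ] Module.End ℝ E) (w : E)
    (X : Fin (2 * k - 1) → E) :
    MultilinearMap.alternatization (curvMultilinear k C w) X = curvSum k C w X := by
  simp only [MultilinearMap.alternatization_apply, curvSum, MultilinearMap.domDomCongr_apply]
  refine Finset.sum_congr rfl fun σ _ => ?_
  rw [Units.smul_def, zsmul_eq_mul]
  rfl

theorem curvTrace_add (C : E →ₗ[ℝ] E →ₗ[ℝ] Module.End ℝ E) (w w' : E)
    (X : Fin (2 * k - 1) → E) :
    curvTrace k C (w + w') X = curvTrace k C w X + curvTrace k C w' X := by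
  simp only [curvTrace, map_add, add_mul]

theorem curvTrace_smul (C : E →ₗ[ℝ] E →ₗ[ℝ] Module.End ℝ E) (c : ℝ) (w : E)
    (X : Fin (2 * k - 1) → E) :
    curvTrace k C (c • w) X = c * curvTrace k C w X := by
  simp only [curvTrace, map_smul, smul_mul_assoc, smul_eq_mul]

/-- `curvTrace` is natural with respect to linear isomorphisms. -/
theorem curvTrace_equiv {E' : Type*} [AddCommGroup E'] [Module ℝ E'] (A : E ≃ₗ[ℝ] E')
    {C : E →ₗ[ℝ] E →ₗ[ℝ] Module.End ℝ E} {C' : E' →ₗ[ℝ] E' →ₗ[ℝ] Module.End ℝ E'}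
    (h : ∀ u v w, C' (A u) (A v) (A w) = A (C u v w)) (w : E) (X : Fin (2 * k - 1) → E) :
    curvTrace k C' (A w) (fun i => A (X i)) = curvTrace k C w X := by
  -- Every factor is conjugated by `A`, hence so is the product, and the trace does not change.
  have hC : ∀ u v, C' (A u) (A v) = A.conjRingEquiv (C u v) := by
    intro u v
    ext z
    obtain ⟨w, rfl⟩ := A.surjective z
    simp [h]
  have hm : ∀ u, (C' (A u)).flip (A w) = A.conjRingEquiv ((C u).flip w) := by
    intro u
    ext z
    obtain ⟨w, rfl⟩ := A.surjective z
    simp [h]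
  simp only [curvTrace, hC, hm]
  have : (List.ofFn fun i : Fin (k - 1) => A.conjRingEquiv
      (C (X ⟨2 * i + 1, by omega⟩) (X ⟨2 * i + 2, by omega⟩))) =
      (List.ofFn fun i : Fin (k - 1) =>
        (C (X ⟨2 * i + 1, by omega⟩) (X ⟨2 * i + 2, by omega⟩))).map A.conjRingEquiv := by
    simp [List.map_ofFn, Function.comp_def]
  rw [this, ← map_list_prod, ← map_mul]
  exact LinearMap.trace_conj' _ A

theorem curvSum_equiv {E' : Type*} [AddCommGroup E'] [Module ℝ E'] (A : E ≃ₗ[ℝ] E')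
    {C : E →ₗ[ℝ] E →ₗ[ℝ] Module.End ℝ E} {C' : E' →ₗ[ℝ] E' →ₗ[ℝ] Module.End ℝ E'}
    (h : ∀ u v w, C' (A u) (A v) (A w) = A (C u v w)) (w : E) (X : Fin (2 * k - 1) → E) :
    curvSum k C' (A w) (fun i => A (X i)) = curvSum k C w X := by
  simp only [curvSum]
  exact Finset.sum_congr rfl fun σ _ => by
    rw [← curvTrace_equiv A h w fun i => X (σ i)]

end Algebra

/-! ### The trace polynomial as a smooth family of alternating forms -/

section Form

variable {E F : Type*} [NormedAddCommGroup E] [NormedSpace ℝ E] [FiniteDimensional ℝ E]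
  [NormedAddCommGroup F] [NormedSpace ℝ F] {s : Set F} {x : F} {r : WithTop ℕ∞}
  {k : ℕ} [NeZero k]

/-- The factors are moved to `E →L[ℝ] E` by the finite-dimensional algebra isomorphism. There,
multiplication is a smooth operation and the trace is a continuous linear functional. -/
theorem ContDiffWithinAt.curvTrace {C : F → E →ₗ[ℝ] E →ₗ[ℝ] Module.End ℝ E}
    (hC : ∀ u v w, ContDiffWithinAt ℝ r (fun y => C y u v w) s x) {w : F → E}
    (hw : ContDiffWithinAt ℝ r w s x) {X : F → Fin (2 * k - 1) → E}
    (hX : ∀ i, ContDiffWithinAt ℝ r (fun y => X y i) s x) :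
    ContDiffWithinAt ℝ r (fun y => LoopCS.curvTrace k (C y) (w y) (X y)) s x := by
  let Φ : (E →L[ℝ] E) ≃ₐ[ℝ] Module.End ℝ E := (Module.End.toContinuousLinearMap E).symm
  let T : (E →L[ℝ] E) →L[ℝ] ℝ :=
    (LinearMap.trace ℝ E ∘ₗ Φ.toLinearMap).toContinuousLinearMap
  have h1 : ∀ B : F → Module.End ℝ E, (∀ v, ContDiffWithinAt ℝ r (fun y => B y v) s x) →
      ContDiffWithinAt ℝ r (fun y => Φ.symm (B y)) s x := fun B hB =>
    contDiffWithinAt_clm_of_apply fun v => hB v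
  have key : ∀ y, LoopCS.curvTrace k (C y) (w y) (X y) =
      T (Φ.symm ((C y (X y ⟨0, by have := NeZero.pos k; omega⟩)).flip (w y)) *
    (List.ofFn fun i : Fin (k - 1) =>
      Φ.symm (C y (X y ⟨2 * i + 1, by omega⟩) (X y ⟨2 * i + 2, by omega⟩))).prod) := by
    intro y
    have : (List.ofFn fun i : Fin (k - 1) =>
        Φ.symm (C y (X y ⟨2 * i + 1, by omega⟩) (X y ⟨2 * i + 2, by omega⟩))) =
        (List.ofFn fun i : Fin (k - 1) =>
          (C y (X y ⟨2 * i + 1, by omega⟩) (X y ⟨2 * i + 2, by omega⟩))).map Φ.symm := by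
      simp [List.map_ofFn, Function.comp_def]
    rw [this, ← map_list_prod, ← map_mul]
    simp [T, LoopCS.curvTrace]
  simp only [key]
  refine T.contDiff.comp_contDiffWithinAt ((h1 _ fun v => ?_).mul
    (contDiffWithinAt_list_prod_ofFn _ fun i => h1 _ fun v => ?_))
  · exact contDiffWithinAt_trilinear hC (hX _) contDiffWithinAt_const hw
  · exact contDiffWithinAt_trilinear hC (hX _) (hX _) contDiffWithinAt_const

theorem ContDiffWithinAt.curvSum {C : F → E →ₗ[ℝ] E →ₗ[ℝ] Module.End ℝ E}
    (hC : ∀ u v w, ContDiffWithinAt ℝ r (fun y => C y u v w) s x) {w : F → E}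
    (hw : ContDiffWithinAt ℝ r w s x) {X : F → Fin (2 * k - 1) → E}
    (hX : ∀ i, ContDiffWithinAt ℝ r (fun y => X y i) s x) :
    ContDiffWithinAt ℝ r (fun y => LoopCS.curvSum k (C y) (w y) (X y)) s x :=
  ContDiffWithinAt.sum fun _ _ => contDiffWithinAt_const.mul
    (ContDiffWithinAt.curvTrace hC hw fun _ => hX _)

/-- The antisymmetrization of `curvTrace` as an alternating form. -/
noncomputable def curvAlternating (k : ℕ) [NeZero k] (C : E →ₗ[ℝ] E →ₗ[ℝ] Module.End ℝ E) (w : E) :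
    E [⋀^Fin (2 * k - 1)]→L[ℝ] ℝ :=
  { MultilinearMap.alternatization (curvMultilinear k C w) with
    cont := by
      -- Continuity is the order-zero case of the smoothness lemma, with the tuple of vectors itself
      -- as parameter.
      have : ContDiff ℝ 0 (fun X => LoopCS.curvSum k C w X) := by
        refine contDiff_iff_contDiffAt.2 fun X => ?_
        refine ContDiffWithinAt.curvSum (fun _ _ _ => contDiffWithinAt_const)
          contDiffWithinAt_const fun i => (contDiff_apply ℝ E i).contDiffAt
      refine this.continuous.congr fun X => ?_
      exact (curvMultilinear_alternatization_apply C w X).symm }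

theorem curvAlternating_apply (C : E →ₗ[ℝ] E →ₗ[ℝ] Module.End ℝ E) (w : E)
    (X : Fin (2 * k - 1) → E) : curvAlternating k C w X = LoopCS.curvSum k C w X :=
  curvMultilinear_alternatization_apply C w X

/-- The antisymmetrization of `curvTrace` as a covector-valued alternating form. -/
noncomputable def curvForm (k : ℕ) [NeZero k] (C : E →ₗ[ℝ] E →ₗ[ℝ] Module.End ℝ E) :
    E →L[ℝ] E [⋀^Fin (2 * k - 1)]→L[ℝ] ℝ :=
  LinearMap.toContinuousLinearMap (𝕜 := ℝ) (E := E) (F' := E [⋀^Fin (2 * k - 1)]→L[ℝ] ℝ)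
    { toFun := curvAlternating k C
      map_add' := fun w w' => by
        ext X
        simp only [ContinuousAlternatingMap.add_apply, curvAlternating_apply, LoopCS.curvSum,
          curvTrace_add, mul_add, Finset.sum_add_distrib]
      map_smul' := fun c w => by
        ext X
        simp only [ContinuousAlternatingMap.smul_apply, curvAlternating_apply, LoopCS.curvSum,
          curvTrace_smul, Finset.mul_sum, mul_left_comm, smul_eq_mul, RingHom.id_apply] }

theorem curvForm_apply (C : E →ₗ[ℝ] E →ₗ[ℝ] Module.End ℝ E) (w : E) (X : Fin (2 * k - 1) → E) :
    curvForm k C w X = LoopCS.curvSum k C w X :=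
  curvAlternating_apply C w X

theorem finiteDimensional_continuousAlternatingMap (n : ℕ) :
    FiniteDimensional ℝ (E [⋀^Fin n]→L[ℝ] ℝ) := by
  let f : (E [⋀^Fin n]→L[ℝ] ℝ) →ₗ[ℝ] MultilinearMap ℝ (fun _ : Fin n => E) ℝ :=
    { toFun := fun η => η.toMultilinearMap
      map_add' := fun _ _ => rfl
      map_smul' := fun _ _ => rfl }
  refine FiniteDimensional.of_injective f fun η η' h => ?_
  ext v
  exact congrArg (fun m => m v) h

theorem contDiffWithinAt_alternating_of_apply {n : ℕ} {f : F → E [⋀^Fin n]→L[ℝ] ℝ}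
    (hf : ∀ v, ContDiffWithinAt ℝ r (fun y => f y v) s x) : ContDiffWithinAt ℝ r f s x := by
  have := finiteDimensional_continuousAlternatingMap (E := E) n
  refine contDiffWithinAt_of_separating
    (fun v => (ContinuousAlternatingMap.apply ℝ E ℝ v).toLinearMap) (fun η h => ?_) hf
  ext v
  exact h v

end Form

/-! ### Naturality of Christoffel symbols and curvature under local isometries -/

section Naturality

open Filter Topology

variable {E : Type*} [NormedAddCommGroup E] [NormedSpace ℝ E]

theorem contDiffAt_fderiv_apply {F : Type*} [NormedAddCommGroup F] [NormedSpace ℝ F] {f : E → F}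
    {y : E} (hf : ContDiffAt ℝ ∞ f y) (v : E) : ContDiffAt ℝ ∞ (fun z => fderiv ℝ f z v) y :=
  (hf.fderiv_right (m := ∞) le_rfl).clm_apply contDiffAt_const

theorem fderiv_fderiv_apply_comm {F : Type*} [NormedAddCommGroup F] [NormedSpace ℝ F] {f : E → F}
    {y : E} (hf : ContDiffAt ℝ ∞ f y) (u v : E) :
    fderiv ℝ (fun z => fderiv ℝ f z v) y u = fderiv ℝ (fun z => fderiv ℝ f z u) y v := by
  have hd : DifferentiableAt ℝ (fderiv ℝ f) y :=
    (hf.fderiv_right (m := ∞) le_rfl).differentiableAt (by simp)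
  have h := (hf.of_le (m := 2) ENat.LEInfty.out).isSymmSndFDerivAt (by simp)
  have key : ∀ a b, fderiv ℝ (fun z => fderiv ℝ f z b) y a = fderiv ℝ (fderiv ℝ f) y a b := by
    intro a b
    rw [fderiv_clm_apply hd (differentiableAt_const b)]
    simp
  rw [key, key]
  exact h.eq u v

set_option synthInstance.maxHeartbeats 400000

theorem fderiv_apply_apply {F G H : Type*} [NormedAddCommGroup F] [NormedSpace ℝ F]
    [NormedAddCommGroup G] [NormedSpace ℝ G] [NormedAddCommGroup H] [NormedSpace ℝ H]
    {f : E → F →L[ℝ] G →L[ℝ] H} {y : E} (hf : DifferentiableAt ℝ f y) (u : E) (v : F) (w : G) :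
    fderiv ℝ f y u v w = fderiv ℝ (fun z => f z v w) y u := by
  have h1 : HasFDerivAt (fun z => f z v w) _ y :=
    (hf.hasFDerivAt.clm_apply (hasFDerivAt_const v y)).clm_apply (hasFDerivAt_const w y)
  rw [h1.fderiv]
  simp

theorem christoffel_apply (G : E → E →L[ℝ] E →L[ℝ] ℝ) (y u v : E) :
    christoffel G y u v = (1 / 2 : ℝ) • (G y).inverse (fderiv ℝ G y u v + fderiv ℝ G y v u -
      ((fderiv ℝ G y).flip u).flip v) := by
  simp only [christoffel, map_add, map_sub]
  rfl

theorem hasFDerivAt_fun_comp {F H : Type*} [NormedAddCommGroup F] [NormedSpace ℝ F]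
    [NormedAddCommGroup H] [NormedSpace ℝ H] {g : F → H} {f : E → F} {y : E}
    (hg : DifferentiableAt ℝ g (f y)) (hf : DifferentiableAt ℝ f y) :
    HasFDerivAt (fun z => g (f z)) ((fderiv ℝ g (f y)).comp (fderiv ℝ f y)) y :=
  hg.hasFDerivAt.comp y hf.hasFDerivAt

/-- The Leibniz rule applied to the isometry relation yields one derivative of `G'` and two terms
with second derivatives of `Φ`; the latter produce the inhomogeneous term in the law for Christoffel
symbols. -/
theorem fderiv_metric_pullback {G G' : E → E →L[ℝ] E →L[ℝ] ℝ} {Φ : E → E} {y : E}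
    (hΦ : ContDiffAt ℝ ∞ Φ y) (hG : DifferentiableAt ℝ G y) (hG' : DifferentiableAt ℝ G' (Φ y))
    (heq : ∀ᶠ z in 𝓝 y, ∀ b c, G' (Φ z) (fderiv ℝ Φ z b) (fderiv ℝ Φ z c) = G z b c) (a b c : E) :
    fderiv ℝ G y a b c = fderiv ℝ G' (Φ y) (fderiv ℝ Φ y a) (fderiv ℝ Φ y b) (fderiv ℝ Φ y c) +
      G' (Φ y) (fderiv ℝ (fun z => fderiv ℝ Φ z b) y a) (fderiv ℝ Φ y c) +
      G' (Φ y) (fderiv ℝ Φ y b) (fderiv ℝ (fun z => fderiv ℝ Φ z c) y a) := by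
  have hd : ∀ v, DifferentiableAt ℝ (fun z => fderiv ℝ Φ z v) y := fun v =>
    (contDiffAt_fderiv_apply hΦ v).differentiableAt (by simp)
  have h1 : HasFDerivAt (fun z => G' (Φ z)) ((fderiv ℝ G' (Φ y)).comp (fderiv ℝ Φ y)) y :=
    hasFDerivAt_fun_comp (g := G') hG' (hΦ.differentiableAt (by simp))
  have h2 := (h1.clm_apply (hd b).hasFDerivAt).clm_apply (hd c).hasFDerivAt
  have hbc : (fun z => G' (Φ z) (fderiv ℝ Φ z b) (fderiv ℝ Φ z c)) =ᶠ[𝓝 y] fun z => G z b c :=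
    heq.mono fun z hz => hz b c
  rw [fderiv_apply_apply hG, ← hbc.fderiv_eq, h2.fderiv]
  simp
  ring

variable [FiniteDimensional ℝ E]

theorem contDiffAt_clm_of_apply {F H : Type*} [NormedAddCommGroup F] [NormedSpace ℝ F]
    [NormedAddCommGroup H] [NormedSpace ℝ H] {f : F → E →L[ℝ] H} {x : F}
    (hf : ∀ v, ContDiffAt ℝ ∞ (fun y => f y v) x) : ContDiffAt ℝ ∞ f x :=
  contDiffWithinAt_clm_of_apply hf

theorem contDiffAt_christoffel_apply {G : E → E →L[ℝ] E →L[ℝ] ℝ} {y : E}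
    (hG : ContDiffAt ℝ ∞ G y) (hi : (G y).IsInvertible) (u v : E) :
    ContDiffAt ℝ ∞ (fun z => christoffel G z u v) y := by
  have hinv : ContDiffAt ℝ ∞ (fun z => (G z).inverse) y :=
    (hi.contDiffAt_map_inverse (n := ∞)).comp y hG
  have hd : ∀ a b c, ContDiffAt ℝ ∞ (fun z => fderiv ℝ G z a b c) y := fun a b c =>
    ((contDiffAt_fderiv_apply hG a).clm_apply contDiffAt_const).clm_apply contDiffAt_const
  simp only [christoffel_apply]
  refine (hinv.clm_apply ?_).const_smul _
  refine contDiffAt_clm_of_apply fun w => ?_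
  exact ((hd u v w).add (hd v u w)).sub (hd w u v)

theorem contDiffAt_christoffel {G : E → E →L[ℝ] E →L[ℝ] ℝ} {y : E}
    (hG : ContDiffAt ℝ ∞ G y) (hi : (G y).IsInvertible) : ContDiffAt ℝ ∞ (christoffel G) y :=
  contDiffAt_clm_of_apply fun u => contDiffAt_clm_of_apply fun v =>
    contDiffAt_christoffel_apply hG hi u v

theorem chartCurvature_apply' {G : E → E →L[ℝ] E →L[ℝ] ℝ} {y : E}
    (hG : ContDiffAt ℝ ∞ G y) (hi : (G y).IsInvertible) (u v w : E) :
    chartCurvature G y u v w =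
      fderiv ℝ (fun z => christoffel G z v w) y u - fderiv ℝ (fun z => christoffel G z u w) y v
        + christoffel G y u (christoffel G y v w) - christoffel G y v (christoffel G y u w) := by
  have h := (contDiffAt_christoffel hG hi).differentiableAt (by simp)
  rw [chartCurvature_apply, fderiv_apply_apply h, fderiv_apply_apply h]

theorem eventually_isInvertible {G : E → E →L[ℝ] E →L[ℝ] ℝ} {y : E}
    (hG : ContinuousAt G y) (hi : (G y).IsInvertible) : ∀ᶠ z in 𝓝 y, (G z).IsInvertible := by
  obtain ⟨e, he⟩ := hi
  exact hG.eventually (he ▸ ContinuousLinearEquiv.nhds e)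

theorem contDiffAt_chartCurvature_apply {G : E → E →L[ℝ] E →L[ℝ] ℝ} {y : E}
    (hG : ∀ᶠ z in 𝓝 y, ContDiffAt ℝ ∞ G z) (hi : (G y).IsInvertible) (u v w : E) :
    ContDiffAt ℝ ∞ (fun z => chartCurvature G z u v w) y := by
  have hG0 := hG.self_of_nhds
  have hev := hG.and (eventually_isInvertible hG0.continuousAt hi)
  have hc := contDiffAt_christoffel_apply hG0 hi
  have hc' := contDiffAt_christoffel hG0 hi
  refine ContDiffAt.congr_of_eventuallyEq ?_
    (hev.mono fun z hz => chartCurvature_apply' hz.1 hz.2 u v w)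
  exact (((contDiffAt_fderiv_apply (hc v w) u).sub (contDiffAt_fderiv_apply (hc u w) v)).add
    ((hc'.clm_apply contDiffAt_const).clm_apply (hc v w))).sub
    ((hc'.clm_apply contDiffAt_const).clm_apply (hc u w))

/-- A kernel vector of `A` would pair to zero with everything under the nondegenerate form `B`;
injectivity suffices in finite dimension. -/
theorem bijective_of_metric_pullback {B B' : E →L[ℝ] E →L[ℝ] ℝ} {A : E →L[ℝ] E}
    (hB : B.IsInvertible) (h : ∀ b c, B' (A b) (A c) = B b c) : Function.Bijective A := by
  have hinj : Function.Injective A := by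
    refine (injective_iff_map_eq_zero A).2 fun b hb => hB.injective ?_
    ext c
    rw [← h, hb]
    simp
  exact ⟨hinj, LinearMap.injective_iff_surjective.1 hinj⟩

/-- Both sides are paired with an arbitrary image vector under the nondegenerate `G'`. Of the six
second-derivative terms in the Koszul formula, four cancel by symmetry and two coincide, which
absorbs the factor 1/2. -/
theorem christoffel_pullback {G G' : E → E →L[ℝ] E →L[ℝ] ℝ} {Φ : E → E} {y : E}
    (hΦ : ContDiffAt ℝ ∞ Φ y) (hG : DifferentiableAt ℝ G y) (hG' : DifferentiableAt ℝ G' (Φ y))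
    (hi : (G y).IsInvertible) (hi' : (G' (Φ y)).IsInvertible)
    (hsymm : ∀ a b, G' (Φ y) a b = G' (Φ y) b a)
    (heq : ∀ᶠ z in 𝓝 y, ∀ b c, G' (Φ z) (fderiv ℝ Φ z b) (fderiv ℝ Φ z c) = G z b c) (u v : E) :
    fderiv ℝ Φ y (christoffel G y u v) = fderiv ℝ (fun z => fderiv ℝ Φ z v) y u +
      christoffel G' (Φ y) (fderiv ℝ Φ y u) (fderiv ℝ Φ y v) := by
  have hb := bijective_of_metric_pullback hi heq.self_of_nhds
  refine hi'.injective ?_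
  ext w'
  obtain ⟨w, rfl⟩ := hb.2 w'
  have hp := fderiv_metric_pullback hΦ hG hG' heq
  rw [heq.self_of_nhds, christoffel_spec G y u v w hi, map_add, add_apply,
    christoffel_spec G' (Φ y) _ _ _ hi', hp, hp, hp, fderiv_fderiv_apply_comm hΦ w v,
    fderiv_fderiv_apply_comm hΦ w u, fderiv_fderiv_apply_comm hΦ v u,
    hsymm (fderiv ℝ Φ y v) (fderiv ℝ (fun z => fderiv ℝ Φ z w) y u)]
  ring

/-- The curvature is natural with respect to local isometries. -/
theorem chartCurvature_pullback {G G' : E → E →L[ℝ] E →L[ℝ] ℝ} {Φ : E → E} {y : E}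
    (hΦ : ∀ᶠ z in 𝓝 y, ContDiffAt ℝ ∞ Φ z) (hG : ∀ᶠ z in 𝓝 y, ContDiffAt ℝ ∞ G z)
    (hG' : ∀ᶠ z in 𝓝 (Φ y), ContDiffAt ℝ ∞ G' z)
    (hi : (G y).IsInvertible) (hi' : (G' (Φ y)).IsInvertible)
    (hsymm : ∀ᶠ z in 𝓝 (Φ y), ∀ a b, G' z a b = G' z b a)
    (heq : ∀ᶠ z in 𝓝 y, ∀ b c, G' (Φ z) (fderiv ℝ Φ z b) (fderiv ℝ Φ z c) = G z b c)
    (u v w : E) :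
    chartCurvature G' (Φ y) (fderiv ℝ Φ y u) (fderiv ℝ Φ y v) (fderiv ℝ Φ y w) =
      fderiv ℝ Φ y (chartCurvature G y u v w) := by
  have hΦc := hΦ.self_of_nhds.continuousAt
  -- The law is needed on a neighbourhood because it is differentiated below.
  have hev : ∀ᶠ z in 𝓝 y, ∀ u v, fderiv ℝ Φ z (christoffel G z u v) =
      fderiv ℝ (fun z => fderiv ℝ Φ z v) z u +
        christoffel G' (Φ z) (fderiv ℝ Φ z u) (fderiv ℝ Φ z v) := by
    filter_upwards [hΦ, hG,
      hΦc.eventually hG', eventually_isInvertible hG.self_of_nhds.continuousAt hi,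
      hΦc.eventually (eventually_isInvertible hG'.self_of_nhds.continuousAt hi'),
      hΦc.eventually hsymm,
      heq.eventually_nhds] with z h1 h2 h3 h4 h5 h6 h7
    exact christoffel_pullback h1 (h2.differentiableAt (by simp)) (h3.differentiableAt (by simp))
      h4 h5 h6 h7
  have h0 := hev.self_of_nhds
  replace hΦ := hΦ.self_of_nhds
  replace hG := hG.self_of_nhds
  replace hG' := hG'.self_of_nhds
  have hdf : DifferentiableAt ℝ (fderiv ℝ Φ) y :=
    (hΦ.fderiv_right (m := ∞) le_rfl).differentiableAt (by simp)
  have hd : ∀ v, DifferentiableAt ℝ (fun z => fderiv ℝ Φ z v) y := fun v =>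
    (contDiffAt_fderiv_apply hΦ v).differentiableAt (by simp)
  have hc' := (contDiffAt_christoffel hG' hi').differentiableAt (by simp)
  -- The law for Christoffel symbols differentiated along `a` and solved for the image of the
  -- derivative of Γ.
  have hderiv : ∀ a u v, fderiv ℝ Φ y (fderiv ℝ (fun z => christoffel G z u v) y a) =
      fderiv ℝ (fun z => fderiv ℝ (fun z => fderiv ℝ Φ z v) z u) y a +
      fderiv ℝ (christoffel G') (Φ y) (fderiv ℝ Φ y a) (fderiv ℝ Φ y u) (fderiv ℝ Φ y v) +
      christoffel G' (Φ y) (fderiv ℝ (fun z => fderiv ℝ Φ z u) y a) (fderiv ℝ Φ y v) +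
      christoffel G' (Φ y) (fderiv ℝ Φ y u) (fderiv ℝ (fun z => fderiv ℝ Φ z v) y a) -
      fderiv ℝ (fun z => fderiv ℝ Φ z (christoffel G y u v)) y a := by
    intro a u v
    have hL := hdf.hasFDerivAt.clm_apply
      ((contDiffAt_christoffel_apply hG hi u v).differentiableAt (by simp)).hasFDerivAt
    have h1 : HasFDerivAt (fun z => christoffel G' (Φ z)) _ y :=
      hasFDerivAt_fun_comp hc' (hΦ.differentiableAt (by simp))
    have hR := ((contDiffAt_fderiv_apply (contDiffAt_fderiv_apply hΦ v) u).differentiableAt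
      (by simp)).hasFDerivAt.add ((h1.clm_apply (hd u).hasFDerivAt).clm_apply (hd v).hasFDerivAt)
    have hLR := congrArg (fun L => L a) (hL.unique
      (hR.congr_of_eventuallyEq (hev.mono fun z hz => hz u v)))
    have hc : fderiv ℝ (fun z => fderiv ℝ Φ z (christoffel G y u v)) y a =
        fderiv ℝ (fderiv ℝ Φ) y a (christoffel G y u v) := by
      rw [fderiv_clm_apply hdf (differentiableAt_const _)]
      simp
    rw [hc, eq_sub_iff_add_eq]
    simp at hLR
    rw [hLR]
    abel
  rw [chartCurvature_apply' hG hi, chartCurvature_apply]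
  simp only [map_sub, map_add, hderiv, h0]
  -- Third derivatives of `Φ` are symmetric and disappear on antisymmetrizing in `u` and `v`. The
  -- other terms with second derivatives of `Φ` cancel by symmetry or against those from the
  -- products of Christoffel symbols.
  rw [fderiv_fderiv_apply_comm (contDiffAt_fderiv_apply hΦ w) v u, fderiv_fderiv_apply_comm hΦ v u]
  abel

end Naturality

/-! ### The metric in a chart: nondegeneracy and smoothness -/

section MetricInChart

open Filter Topology

set_option synthInstance.maxHeartbeats 400000

variable {n : ℕ} {M : Type*} [TopologicalSpace M] [ChartedSpace (Euc n) M]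
  [IsManifold (𝓡 n) ∞ M] (g : RiemMetric n M)

theorem metricInChart_apply (c : M) (y u v : Euc n) :
    metricInChart g c y u v = g.inner ((extChartAt (𝓡 n) c).symm y)
      (mfderiv 𝓘(ℝ, Euc n) (𝓡 n) (extChartAt (𝓡 n) c).symm y u)
      (mfderiv 𝓘(ℝ, Euc n) (𝓡 n) (extChartAt (𝓡 n) c).symm y v) := rfl

theorem metricInChart_symm (c : M) (y u v : Euc n) :
    metricInChart g c y u v = metricInChart g c y v u := g.symm _ _ _

theorem isInvertible_mfderiv_extChartAt_symm (c : M) {y : Euc n}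
    (hy : y ∈ (extChartAt (𝓡 n) c).target) :
    (mfderiv 𝓘(ℝ, Euc n) (𝓡 n) (extChartAt (𝓡 n) c).symm y).IsInvertible := by
  have : IsManifold (𝓡 n) 1 M := IsManifold.of_le (n := ∞) ENat.LEInfty.out
  have h := isInvertible_mfderivWithin_extChartAt_symm (I := 𝓡 n) hy
  rwa [modelWithCornersSelf_coe, Set.range_id, mfderivWithin_univ] at h

theorem isInvertible_metricInChart (c : M) {y : Euc n} (hy : y ∈ (extChartAt (𝓡 n) c).target) :
    (metricInChart g c y).IsInvertible := by
  have hinj : Function.Injective (metricInChart g c y) := by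
    refine (injective_iff_map_eq_zero _).2 fun u hu => ?_
    by_contra hne
    have h1 : mfderiv 𝓘(ℝ, Euc n) (𝓡 n) (extChartAt (𝓡 n) c).symm y u ≠ 0 := fun h0 =>
      hne ((isInvertible_mfderiv_extChartAt_symm c hy).injective (h0.trans (map_zero _).symm))
    have h2 := g.pos _ _ h1
    rw [← metricInChart_apply, hu] at h2
    exact lt_irrefl _ h2
  have hfr : Module.finrank ℝ (Euc n) = Module.finrank ℝ (Euc n →L[ℝ] ℝ) := by
    rw [← (LinearMap.toContinuousLinearMap (𝕜 := ℝ) (E := Euc n) (F' := ℝ)).finrank_eq]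
    exact (Subspace.dual_finrank_eq (K := ℝ) (V := Euc n)).symm
  exact ⟨(LinearEquiv.ofInjectiveOfFinrankEq (metricInChart g c y).toLinearMap hinj
    hfr).toContinuousLinearEquiv, by ext; rfl⟩

theorem metricInChart_extChartAt (c : M) {q : M} (hq : q ∈ (extChartAt (𝓡 n) c).source)
    (u v : TangentSpace (𝓡 n) q) :
    metricInChart g c (extChartAt (𝓡 n) c q)
      (mfderiv (𝓡 n) 𝓘(ℝ, Euc n) (extChartAt (𝓡 n) c) q u)
      (mfderiv (𝓡 n) 𝓘(ℝ, Euc n) (extChartAt (𝓡 n) c) q v) = g.inner q u v := by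
  have : IsManifold (𝓡 n) 1 M := IsManifold.of_le (n := ∞) ENat.LEInfty.out
  have h := mfderivWithin_extChartAt_symm_comp_mfderiv_extChartAt' (I := 𝓡 n) hq
  rw [modelWithCornersSelf_coe, Set.range_id, mfderivWithin_univ] at h
  have hid : ∀ w : TangentSpace (𝓡 n) q,
      (mfderiv 𝓘(ℝ, Euc n) (𝓡 n) (extChartAt (𝓡 n) c).symm (extChartAt (𝓡 n) c q)
        (mfderiv (𝓡 n) 𝓘(ℝ, Euc n) (extChartAt (𝓡 n) c) q w) : Euc n) = w := fun w =>
    congrArg (fun L : Euc n →L[ℝ] Euc n => L w) h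
  -- The point obtained by applying the chart and its inverse equals `q` only propositionally. All
  -- tangent spaces unfold to `Euc n`, so the base point can be generalized and substituted.
  have hp : ∀ p, p = q → ∀ a b : Euc n, g.inner p a b = g.inner q a b := by
    rintro _ rfl a b
    rfl
  exact (hp _ ((extChartAt (𝓡 n) c).left_inv hq) _ _).trans
    (congrArg₂ (fun a b : Euc n => g.inner q a b) (hid u) (hid v))

/-- The coordinate vector fields are smooth sections of the tangent bundle and the metric is a
smooth section of bilinear forms. Their contraction is smooth in a trivial bundle, whose fibre
component is the matrix entry. -/
theorem contDiffAt_metricInChart (c : M) {y : Euc n} (hy : y ∈ (extChartAt (𝓡 n) c).target) :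
    ContDiffAt ℝ ∞ (metricInChart g c) y := by
  refine contDiffAt_clm_of_apply fun u => contDiffAt_clm_of_apply fun v => ?_
  have hopen : IsOpen (extChartAt (𝓡 n) c).target := isOpen_extChartAt_target c
  have hvec : ∀ u : Euc n, ContMDiffAt 𝓘(ℝ, Euc n) (𝓡 n).tangent ∞ (fun z =>
      (⟨(extChartAt (𝓡 n) c).symm z, mfderiv 𝓘(ℝ, Euc n) (𝓡 n) (extChartAt (𝓡 n) c).symm z u⟩ :
        TangentBundle (𝓡 n) M)) y := by
    intro u
    have h1 : ContMDiff 𝓘(ℝ, Euc n) 𝓘(ℝ, Euc n).tangent ∞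
        (fun z => (⟨z, u⟩ : TangentBundle 𝓘(ℝ, Euc n) (Euc n))) :=
      contMDiff_vectorSpace_iff_contDiff.2 contDiff_const
    have h2 := (contMDiffOn_extChartAt_symm (I := 𝓡 n) (n := ∞) c).contMDiffOn_tangentMapWithin
      (m := ∞) le_rfl hopen.uniqueMDiffOn
    have h3 := (h2.comp h1.contMDiffOn (s := (extChartAt (𝓡 n) c).target)
      fun z hz => hz).contMDiffAt
      (hopen.mem_nhds hy)
    refine h3.congr_of_eventuallyEq ?_
    filter_upwards [hopen.mem_nhds hy] with z hz
    simp only [Function.comp, tangentMapWithin]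
    rw [mfderivWithin_of_mem_nhds (hopen.mem_nhds hz)]
  have hb := (contMDiffOn_extChartAt_symm (I := 𝓡 n) (n := ∞) c).contMDiffAt (hopen.mem_nhds hy)
  have hg := g.contMDiff.contMDiffAt.comp y hb
  have key : ContMDiffAt 𝓘(ℝ, Euc n) ((𝓡 n).prod 𝓘(ℝ)) ∞
      (fun z ↦ Bundle.TotalSpace.mk' ℝ (E := Bundle.Trivial M ℝ) ((extChartAt (𝓡 n) c).symm z)
        (metricInChart g c z u v)) y := by
    apply ContMDiffAt.clm_bundle_apply₂ (F₁ := Euc n) (F₂ := Euc n)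
    · exact hg
    · exact hvec u
    · exact hvec v
  simp only [Bundle.contMDiffAt_totalSpace] at key
  exact key.2.contDiffAt

end MetricInChart

/-! ### The curvature tensor on the manifold and its behaviour under isometries -/

section Curvature

open Filter Topology

set_option synthInstance.maxHeartbeats 400000

theorem chartCurvature_swap {E : Type*} [NormedAddCommGroup E] [NormedSpace ℝ E]
    (G : E → E →L[ℝ] E →L[ℝ] ℝ) (y u v w : E) :
    chartCurvature G y u v w = -chartCurvature G y v u w := by
  rw [chartCurvature_apply, chartCurvature_apply]
  abel

/-- The curvature of a metric on an open set of a vector space, as a trilinear map. -/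
noncomputable def chartCurv {E : Type*} [NormedAddCommGroup E] [NormedSpace ℝ E]
    (G : E → E →L[ℝ] E →L[ℝ] ℝ) (y : E) : E →ₗ[ℝ] E →ₗ[ℝ] Module.End ℝ E :=
  LinearMap.mk₂ ℝ (fun u v => ((chartCurvature G y u v).toLinearMap : Module.End ℝ E))
    (fun u u' v => LinearMap.ext fun w => by
      change chartCurvature G y (u + u') v w = chartCurvature G y u v w + chartCurvature G y u' v w
      rw [chartCurvature_swap, chartCurvature_add_right, neg_add, ← chartCurvature_swap,
        ← chartCurvature_swap])
    (fun c u v => LinearMap.ext fun w => by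
      change chartCurvature G y (c • u) v w = c • chartCurvature G y u v w
      rw [chartCurvature_swap, chartCurvature_smul_right, ← smul_neg, ← chartCurvature_swap])
    (fun u v v' => LinearMap.ext fun w => chartCurvature_add_right G y u v v' w)
    (fun c u v => LinearMap.ext fun w => chartCurvature_smul_right G y u v w c)

section

variable {n : ℕ} {M : Type*} [TopologicalSpace M] [ChartedSpace (Euc n) M]
  [IsManifold (𝓡 n) ∞ M] (g : RiemMetric n M)

theorem contDiffAt_chartCurv_metricInChart (c : M) {y : Euc n}
    (hy : y ∈ (extChartAt (𝓡 n) c).target) (u v w : Euc n) :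
    ContDiffAt ℝ ∞ (fun z => chartCurv (metricInChart g c) z u v w) y := by
  refine contDiffAt_chartCurvature_apply ?_ (isInvertible_metricInChart g c hy) u v w
  filter_upwards [(isOpen_extChartAt_target (I := 𝓡 n) c).mem_nhds hy] with z hz
  exact contDiffAt_metricInChart g c hz

/-- The tangent space at `m` is identified with the model space through the chart preferred at `m`,
so that chart has identity differential there. -/
theorem chartDiff_eq_id (m : M) : chartDiff n m = ContinuousLinearMap.id ℝ (Euc n) := by
  have : IsManifold (𝓡 n) 1 M := IsManifold.of_le (n := ∞) ENat.LEInfty.out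
  exact mfderiv_extChartAt_self

theorem curvature_eq (m : M) (u v : TangentSpace (𝓡 n) m) :
    (curvature g m u v : TangentSpace (𝓡 n) m →ₗ[ℝ] TangentSpace (𝓡 n) m) =
      chartCurv (metricInChart g m) (extChartAt (𝓡 n) m m) u v := by
  ext w
  change (chartDiff n m).inverse (chartCurvature (metricInChart g m) (extChartAt (𝓡 n) m m)
    (chartDiff n m u) (chartDiff n m v) (chartDiff n m w)) = _
  rw [chartDiff_eq_id]
  erw [ContinuousLinearMap.inverse_id]
  rfl

/-- The curvature tensors in two charts correspond to each other under an isometric map. -/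
theorem chartCurv_isometry {f : M → M} (hf : ContMDiff (𝓡 n) (𝓡 n) ∞ f)
    (hiso : ∀ (m : M) (u v : TangentSpace (𝓡 n) m),
      g.inner (f m) (mfderiv (𝓡 n) (𝓡 n) f m u) (mfderiv (𝓡 n) (𝓡 n) f m v) = g.inner m u v)
    (m c : M) (hc : f m ∈ (extChartAt (𝓡 n) c).source) :
    ∃ A : Euc n ≃ₗ[ℝ] Euc n,
      (∀ u, A u = mfderiv (𝓡 n) 𝓘(ℝ, Euc n) (extChartAt (𝓡 n) c) (f m)
        (mfderiv (𝓡 n) (𝓡 n) f m u)) ∧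
      ∀ u v w, chartCurv (metricInChart g c) (extChartAt (𝓡 n) c (f m)) (A u) (A v) (A w) =
        A (chartCurv (metricInChart g m) (extChartAt (𝓡 n) m m) u v w) := by
  have : IsManifold (𝓡 n) 1 M := IsManifold.of_le (n := ∞) ENat.LEInfty.out
  let b := extChartAt (𝓡 n) m
  let b' := extChartAt (𝓡 n) c
  -- The isometry in the charts around `m` and `c` is a local isometry between open sets of `Euc n`,
  -- and its differential at the centre serves as `A`.
  let Φ : Euc n → Euc n := b' ∘ f ∘ b.symm
  have hy : b m ∈ b.target := mem_extChartAt_target m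
  have hbm : b.symm (b m) = m := extChartAt_to_inv m
  have hopen : IsOpen b.target := isOpen_extChartAt_target m
  have hopen' : IsOpen b'.target := isOpen_extChartAt_target c
  have hcont : ContinuousAt (f ∘ b.symm) (b m) :=
    hf.continuous.continuousAt.comp (continuousAt_extChartAt_symm m)
  have hnear : ∀ᶠ z in 𝓝 (b m), z ∈ b.target ∧ f (b.symm z) ∈ b'.source := by
    refine (hopen.eventually_mem hy).and (hcont.eventually_mem ?_)
    simp only [Function.comp, hbm]
    exact extChartAt_source_mem_nhds' hc
  have hs : ∀ {z}, z ∈ b.target → ContMDiffAt 𝓘(ℝ, Euc n) (𝓡 n) ∞ b.symm z := fun {z} hz =>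
    (contMDiffOn_extChartAt_symm (I := 𝓡 n) (n := ∞) m).contMDiffAt (hopen.mem_nhds hz)
  have hs' : ∀ {q}, q ∈ b'.source → ContMDiffAt (𝓡 n) 𝓘(ℝ, Euc n) ∞ b' q := fun {q} hq =>
    contMDiffAt_extChartAt' (by rwa [← extChartAt_source (𝓡 n)])
  have hΦ : ∀ᶠ z in 𝓝 (b m), ContDiffAt ℝ ∞ Φ z := by
    filter_upwards [hnear] with z hz
    exact ((hs' hz.2).comp z (hf.contMDiffAt.comp z (hs hz.1))).contDiffAt
  have hdΦ : ∀ {z}, z ∈ b.target → f (b.symm z) ∈ b'.source → ∀ u, fderiv ℝ Φ z u =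
      mfderiv (𝓡 n) 𝓘(ℝ, Euc n) b' (f (b.symm z)) (mfderiv (𝓡 n) (𝓡 n) f (b.symm z)
        (mfderiv 𝓘(ℝ, Euc n) (𝓡 n) b.symm z u)) := by
    intro z hz hz' u
    have h1 := ((hs hz).mdifferentiableAt (by simp)).hasMFDerivAt
    have h2 := (hf.contMDiffAt.mdifferentiableAt (x := b.symm z) (by simp)).hasMFDerivAt
    have h3 := ((hs' hz').mdifferentiableAt (by simp)).hasMFDerivAt
    let D : Euc n →L[ℝ] Euc n := (mfderiv (𝓡 n) 𝓘(ℝ, Euc n) b' (f (b.symm z))).comp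
      ((mfderiv (𝓡 n) (𝓡 n) f (b.symm z)).comp (mfderiv 𝓘(ℝ, Euc n) (𝓡 n) b.symm z))
    have h4 : HasFDerivAt Φ D z := (h3.comp z (h2.comp z h1)).hasFDerivAt
    rw [h4.fderiv]
    rfl
  have hmet : ∀ᶠ z in 𝓝 (b m), ∀ u v, metricInChart g c (Φ z) (fderiv ℝ Φ z u) (fderiv ℝ Φ z v) =
      metricInChart g m z u v := by
    filter_upwards [hnear] with z hz u v
    rw [hdΦ hz.1 hz.2, hdΦ hz.1 hz.2]
    exact (metricInChart_extChartAt g c hz.2 _ _).trans (hiso _ _ _)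
  have hym : f (b.symm (b m)) ∈ b'.source := by rwa [hbm]
  have hy' : Φ (b m) ∈ b'.target := b'.map_source hym
  have hi := isInvertible_metricInChart g m hy
  have hpull := chartCurvature_pullback (Φ := Φ) (y := b m) hΦ
    (by filter_upwards [hopen.mem_nhds hy] with z hz using contDiffAt_metricInChart g m hz)
    (by filter_upwards [hopen'.mem_nhds hy'] with z hz using contDiffAt_metricInChart g c hz)
    hi (isInvertible_metricInChart g c hy') (Eventually.of_forall fun z => metricInChart_symm g c z)
    hmet
  have hA := bijective_of_metric_pullback hi hmet.self_of_nhds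
  refine ⟨LinearEquiv.ofBijective (fderiv ℝ Φ (b m)).toLinearMap hA, fun u => ?_, fun u v w => ?_⟩
  · have hid : mfderiv 𝓘(ℝ, Euc n) (𝓡 n) b.symm (b m) = ContinuousLinearMap.id ℝ (Euc n) := by
      have h := mfderivWithin_range_extChartAt_symm (I := 𝓡 n) (x := m)
      rwa [modelWithCornersSelf_coe, Set.range_id, mfderivWithin_univ] at h
    have h := hdΦ hy hym u
    rw [hid] at h
    have hp : ∀ p, p = m → ∀ a : Euc n,
        (mfderiv (𝓡 n) 𝓘(ℝ, Euc n) b' (f p) (mfderiv (𝓡 n) (𝓡 n) f p a) : Euc n) =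
          mfderiv (𝓡 n) 𝓘(ℝ, Euc n) b' (f m) (mfderiv (𝓡 n) (𝓡 n) f m a) := by
      rintro _ rfl a
      rfl
    exact h.trans (hp _ hbm u)
  · have hΦm : Φ (b m) = b' (f m) := by simp [Φ, hbm]
    rw [← hΦm]
    exact hpull u v w

end

end Curvature

/-! ### Isometry invariance and chart independence of the tensor K -/

section KTensor

variable {k : ℕ} [NeZero k] {M : Type*} [TopologicalSpace M] [ChartedSpace (Euc (2 * k - 1)) M]
  [IsManifold (𝓡 (2 * k - 1)) ∞ M] (g : RiemMetric (2 * k - 1) M)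

/-- The curvature tensor at `m` on the model space, computed in the chart around `m`. -/
noncomputable def curvAt (g : RiemMetric (2 * k - 1) M) (m : M) :
    Euc (2 * k - 1) →ₗ[ℝ] Euc (2 * k - 1) →ₗ[ℝ] Module.End ℝ (Euc (2 * k - 1)) :=
  chartCurv (metricInChart g m) (extChartAt (𝓡 (2 * k - 1)) m m)

theorem kTensor_eq_curvSum (m : M) (w : TangentSpace (𝓡 (2 * k - 1)) m)
    (X : Fin (2 * k - 1) → TangentSpace (𝓡 (2 * k - 1)) m) :
    kTensor g m w X = curvSum k (curvAt g m) (w : Euc (2 * k - 1))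
      (X : Fin (2 * k - 1) → Euc (2 * k - 1)) := by
  have hmid : ∀ u w : TangentSpace (𝓡 (2 * k - 1)) m,
      curvatureMiddle g m u w = (curvAt g m u).flip w := fun u w =>
    LinearMap.ext fun v => congrArg
      (fun L : Euc (2 * k - 1) →ₗ[ℝ] Euc (2 * k - 1) => L w) (curvature_eq g m u v)
  simp only [kTensor, hmid, curvature_eq]
  rfl

/-- The tensor `K` is preserved by isometries, and can be computed in any chart. -/
theorem kTensor_eq_curvSum_chart {f : M → M}
    (hf : ContMDiff (𝓡 (2 * k - 1)) (𝓡 (2 * k - 1)) ∞ f)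
    (hiso : ∀ (m : M) (u v : TangentSpace (𝓡 (2 * k - 1)) m),
      g.inner (f m) (mfderiv (𝓡 (2 * k - 1)) (𝓡 (2 * k - 1)) f m u)
        (mfderiv (𝓡 (2 * k - 1)) (𝓡 (2 * k - 1)) f m v) = g.inner m u v)
    (m c : M) (hc : f m ∈ (extChartAt (𝓡 (2 * k - 1)) c).source)
    (w : TangentSpace (𝓡 (2 * k - 1)) m) (X : Fin (2 * k - 1) → TangentSpace (𝓡 (2 * k - 1)) m) :
    kTensor g m w X =
      curvSum k (chartCurv (metricInChart g c) (extChartAt (𝓡 (2 * k - 1)) c (f m)))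
        (mfderiv (𝓡 (2 * k - 1)) 𝓘(ℝ, Euc (2 * k - 1)) (extChartAt (𝓡 (2 * k - 1)) c) (f m)
          (mfderiv (𝓡 (2 * k - 1)) (𝓡 (2 * k - 1)) f m w))
        (fun i => mfderiv (𝓡 (2 * k - 1)) 𝓘(ℝ, Euc (2 * k - 1)) (extChartAt (𝓡 (2 * k - 1)) c) (f m)
          (mfderiv (𝓡 (2 * k - 1)) (𝓡 (2 * k - 1)) f m (X i))) := by
  obtain ⟨A, hA, hC⟩ := chartCurv_isometry g hf hiso m c hc
  refine (kTensor_eq_curvSum g m w X).trans ((curvSum_equiv A hC _ _).symm.trans ?_)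
  exact congrArg₂ (curvSum k _) (hA w) (funext fun i => hA (X i))

/-- The identity is an isometry, so a change of chart is a special case of invariance. -/
theorem kTensor_eq_curvSum_of_mem_source (m c : M)
    (hc : m ∈ (extChartAt (𝓡 (2 * k - 1)) c).source)
    (w : TangentSpace (𝓡 (2 * k - 1)) m) (X : Fin (2 * k - 1) → TangentSpace (𝓡 (2 * k - 1)) m) :
    kTensor g m w X =
      curvSum k (chartCurv (metricInChart g c) (extChartAt (𝓡 (2 * k - 1)) c m))
        (mfderiv (𝓡 (2 * k - 1)) 𝓘(ℝ, Euc (2 * k - 1)) (extChartAt (𝓡 (2 * k - 1)) c) m w)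
        (fun i => mfderiv (𝓡 (2 * k - 1)) 𝓘(ℝ, Euc (2 * k - 1))
          (extChartAt (𝓡 (2 * k - 1)) c) m (X i)) := by
  have h := kTensor_eq_curvSum_chart g (f := id) contMDiff_id
    (fun m u v => by simp [mfderiv_id]) m c hc w X
  simp only [mfderiv_id] at h
  exact h

end KTensor

/-! ### Differentiation under the integral sign on sets with boundary -/

section ParametricIntegral

open Filter Topology Set

universe u

variable {P V : Type u} [NormedAddCommGroup P] [NormedSpace ℝ P] [NormedAddCommGroup V]
  [NormedSpace ℝ V] {s : Set P} {a b : ℝ}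

theorem continuous_section_of_continuousOn {P W : Type*} [TopologicalSpace P] [TopologicalSpace W]
    {s : Set P} {f : P × ℝ → W} (hf : ContinuousOn f (s ×ˢ univ)) {x : P} (hx : x ∈ s) :
    Continuous fun θ => f (x, θ) :=
  hf.comp_continuous (by fun_prop) fun θ => ⟨hx, mem_univ θ⟩

/-- Uniformity in θ comes from compactness of the interval of integration. -/
theorem eventually_forall_norm_sub_le {P V : Type*} [TopologicalSpace P]
    [NormedAddCommGroup V] {s : Set P} {a b : ℝ} {f : P × ℝ → V}
    (hf : ContinuousOn f (s ×ˢ univ)) {x : P}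
    (hx : x ∈ s) {ε : ℝ} (hε : 0 < ε) :
    ∀ᶠ z in 𝓝[s] x, ∀ θ ∈ uIcc a b, ‖f (z, θ) - f (x, θ)‖ ≤ ε := by
  have h : ∀ᶠ z in 𝓝 x, ∀ θ ∈ uIcc a b, z ∈ s → ‖f (z, θ) - f (x, θ)‖ ≤ ε := by
    refine isCompact_uIcc.eventually_forall_of_forall_eventually fun θ _ => ?_
    have hc : ContinuousWithinAt (fun q : P × ℝ => ‖f q - f (x, q.2)‖) (s ×ˢ univ) (x, θ) := by
      refine ((hf _ ⟨hx, mem_univ θ⟩).sub ?_).norm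
      exact ((continuous_section_of_continuousOn hf hx).comp
        continuous_snd).continuousWithinAt
    have hlt := hc.eventually (Iio_mem_nhds (by simpa using hε))
    rw [eventually_nhdsWithin_iff] at hlt
    filter_upwards [hlt] with q hq hqs
    exact (hq ⟨hqs, mem_univ _⟩).le
  rw [eventually_nhdsWithin_iff]
  filter_upwards [h] with z hz hzs θ hθ using hz θ hθ hzs

/-- The set `s` need not be open: local convexity is enough for the mean value inequality, which
bounds the error in `f` by the oscillation of `f'` near `x`, uniformly in θ. -/
theorem hasFDerivWithinAt_intervalIntegral [CompleteSpace V] {f : P × ℝ → V}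
    {f' : P × ℝ → P →L[ℝ] V} (hf : ContinuousOn f (s ×ˢ univ)) (hf' : ContinuousOn f' (s ×ˢ univ))
    (hd : ∀ x ∈ s, ∀ θ, HasFDerivWithinAt (fun z => f (z, θ)) (f' (x, θ)) s x) {x : P} (hx : x ∈ s)
    (hconv : ∃ ε > 0, Convex ℝ (s ∩ Metric.ball x ε)) :
    HasFDerivWithinAt (fun z => ∫ θ in a..b, f (z, θ)) (∫ θ in a..b, f' (x, θ)) s x := by
  obtain ⟨r, hr, hc⟩ := hconv
  rw [hasFDerivWithinAt_iff_isLittleO, Asymptotics.isLittleO_iff]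
  intro ε hε
  -- Adding 1 keeps the denominator positive when `a = b`.
  have hC : 0 < ε / (|b - a| + 1) := by positivity
  have h1 := eventually_forall_norm_sub_le (a := a) (b := b) hf' hx hC
  rw [eventually_nhdsWithin_iff, Metric.eventually_nhds_iff_ball] at h1
  obtain ⟨δ, hδ, hball⟩ := h1
  have hmem : s ∩ Metric.ball x (min r δ) ∈ 𝓝[s] x :=
    inter_mem_nhdsWithin s (Metric.ball_mem_nhds x (lt_min hr hδ))
  have hc' : Convex ℝ (s ∩ Metric.ball x (min r δ)) := by
    have := hc.inter (convex_ball x (min r δ))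
    rwa [inter_assoc, inter_eq_right.2 (Metric.ball_subset_ball (min_le_left _ _))] at this
  filter_upwards [hmem] with z hz
  have hi : ∀ z ∈ s, IntervalIntegrable (fun θ => f (z, θ)) MeasureTheory.volume a b := fun z hz =>
    (continuous_section_of_continuousOn hf hz).intervalIntegrable _ _
  have hi' : IntervalIntegrable (fun θ => f' (x, θ)) MeasureTheory.volume a b :=
    (continuous_section_of_continuousOn hf' hx).intervalIntegrable _ _
  have hi'' : IntervalIntegrable (fun θ => f' (x, θ) (z - x)) MeasureTheory.volume a b :=
    ((continuous_section_of_continuousOn hf' hx).clm_apply continuous_const).intervalIntegrable _ _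
  rw [ContinuousLinearMap.intervalIntegral_apply hi',
    ← intervalIntegral.integral_sub (hi z hz.1) (hi x hx),
    ← intervalIntegral.integral_sub ((hi z hz.1).sub (hi x hx)) hi'']
  have hbound : ∀ θ ∈ uIoc a b, ‖f (z, θ) - f (x, θ) - f' (x, θ) (z - x)‖ ≤
      ε / (|b - a| + 1) * ‖z - x‖ := by
    intro θ hθ
    refine hc'.norm_image_sub_le_of_norm_hasFDerivWithin_le' (f := fun z => f (z, θ))
      (f' := fun z => f' (z, θ)) (φ := f' (x, θ)) (fun w hw => ?_) (fun w hw => ?_)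
      ⟨hx, Metric.mem_ball_self (lt_min hr hδ)⟩ hz
    · exact (hd w hw.1 θ).mono inter_subset_left
    · exact hball w (Metric.ball_subset_ball (min_le_right _ _) hw.2) hw.1 θ (uIoc_subset_uIcc hθ)
  refine (intervalIntegral.norm_integral_le_of_norm_le_const hbound).trans ?_
  have : ε / (|b - a| + 1) * ‖z - x‖ * |b - a| = (|b - a| / (|b - a| + 1)) * (ε * ‖z - x‖) := by
    field_simp
  rw [this]
  refine mul_le_of_le_one_left (by positivity) ?_
  rw [div_le_one (by positivity)]
  linarith

theorem hasFDerivWithinAt_section {f : P × ℝ → V} {x : P} {θ : ℝ}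
    (hf : DifferentiableWithinAt ℝ f (s ×ˢ univ) (x, θ)) :
    HasFDerivWithinAt (fun z => f (z, θ))
      ((fderivWithin ℝ f (s ×ˢ univ) (x, θ)).comp (ContinuousLinearMap.inl ℝ P ℝ)) s x := by
  have h1 : HasFDerivWithinAt (fun z : P => (z, θ)) (ContinuousLinearMap.inl ℝ P ℝ) s x :=
    (hasFDerivAt_prodMk_left x θ).hasFDerivWithinAt
  exact HasFDerivWithinAt.comp (t := s ×ˢ univ) x hf.hasFDerivWithinAt h1
    fun z hz => ⟨hz, mem_univ θ⟩

theorem ContDiffOn.fderivWithin_comp_inl (hs : UniqueDiffOn ℝ s) {f : P × ℝ → V}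
    (hf : ContDiffOn ℝ ∞ f (s ×ˢ univ)) :
    ContDiffOn ℝ ∞ (fun q => (fderivWithin ℝ f (s ×ˢ univ) q).comp (ContinuousLinearMap.inl ℝ P ℝ))
      (s ×ˢ univ) :=
  (hf.fderivWithin (hs.prod uniqueDiffOn_univ) (m := ∞) le_rfl).clm_comp contDiffOn_const

theorem fderivWithin_intervalIntegral [CompleteSpace V] (hs : UniqueDiffOn ℝ s)
    (hconv : ∀ x ∈ s, ∃ ε > 0, Convex ℝ (s ∩ Metric.ball x ε)) {f : P × ℝ → V}
    (hf : ContDiffOn ℝ ∞ f (s ×ˢ univ)) {x : P} (hx : x ∈ s) :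
    HasFDerivWithinAt (fun z => ∫ θ in a..b, f (z, θ)) (∫ θ in a..b,
      (fderivWithin ℝ f (s ×ˢ univ) (x, θ)).comp (ContinuousLinearMap.inl ℝ P ℝ)) s x :=
  hasFDerivWithinAt_intervalIntegral hf.continuousOn
    (ContDiffOn.fderivWithin_comp_inl hs hf).continuousOn
    (fun z hz θ => hasFDerivWithinAt_section (hf.differentiableOn (by simp) _ ⟨hz, mem_univ θ⟩))
    hx (hconv x hx)

/-- The derivative of the integral is again such an integral, with values in `P →L[ℝ] V`. Hence `V`
varies in the induction, and `P` shares its universe so that this space is admissible. -/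
theorem contDiffOn_intervalIntegral_nat (hs : UniqueDiffOn ℝ s)
    (hconv : ∀ x ∈ s, ∃ ε > 0, Convex ℝ (s ∩ Metric.ball x ε)) (n : ℕ) :
    ∀ {V : Type u} [NormedAddCommGroup V] [NormedSpace ℝ V] [CompleteSpace V] {f : P × ℝ → V},
      ContDiffOn ℝ ∞ f (s ×ˢ univ) → ContDiffOn ℝ n (fun x => ∫ θ in a..b, f (x, θ)) s := by
  induction n with
  | zero =>
    intro V _ _ _ f hf
    exact contDiffOn_zero.2 fun x hx =>
      (fderivWithin_intervalIntegral hs hconv hf hx).continuousWithinAt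
  | succ n ih =>
    intro V _ _ _ f hf
    have hd := fun x hx => fderivWithin_intervalIntegral (a := a) (b := b) hs hconv hf (x := x) hx
    rw [show ((n + 1 : ℕ) : WithTop ℕ∞) = n + 1 by norm_cast, contDiffOn_succ_iff_fderivWithin hs]
    refine ⟨fun x hx => (hd x hx).differentiableWithinAt, by simp, ?_⟩
    exact (ih (ContDiffOn.fderivWithin_comp_inl hs hf)).congr fun x hx =>
      (hd x hx).fderivWithin (hs x hx)

/-- Differentiation under the integral sign, on a locally convex domain with unique derivatives. -/
theorem contDiffOn_intervalIntegral [CompleteSpace V] (hs : UniqueDiffOn ℝ s)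
    (hconv : ∀ x ∈ s, ∃ ε > 0, Convex ℝ (s ∩ Metric.ball x ε)) {f : P × ℝ → V}
    (hf : ContDiffOn ℝ ∞ f (s ×ˢ univ)) : ContDiffOn ℝ ∞ (fun x => ∫ θ in a..b, f (x, θ)) s :=
  contDiffOn_infty.2 fun n => contDiffOn_intervalIntegral_nat hs hconv n hf

end ParametricIntegral

/-! ### Forms on a tangent bundle contracted with vertical vectors -/

section Transgression

open Filter Topology Set

set_option synthInstance.maxHeartbeats 400000

variable {E : Type*} [NormedAddCommGroup E] [NormedSpace ℝ E] {n : ℕ}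

theorem hasFDerivAt_clm_apply_snd {H : Type*} [NormedAddCommGroup H] [NormedSpace ℝ H]
    {κ : E → E →L[ℝ] H} {y w : E} (hκ : DifferentiableAt ℝ κ y) :
    HasFDerivAt (fun p : E × E => κ p.1 p.2) ((κ y).comp (ContinuousLinearMap.snd ℝ E E) +
      ((fderiv ℝ κ y).comp (ContinuousLinearMap.fst ℝ E E)).flip w) (y, w) := by
  have h1 : HasFDerivAt (fun p : E × E => κ p.1)
      ((fderiv ℝ κ y).comp (ContinuousLinearMap.fst ℝ E E)) (y, w) :=
    HasFDerivAt.comp (g := κ) (y, w) (by exact hκ.hasFDerivAt) hasFDerivAt_fst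
  exact h1.clm_apply hasFDerivAt_snd

theorem differentiableAt_vertical {κ : E → E →L[ℝ] E [⋀^Fin n]→L[ℝ] ℝ} {y w : E}
    (hκ : DifferentiableAt ℝ κ y) : DifferentiableAt ℝ (fun p : E × E =>
      (κ p.1 p.2).compContinuousLinearMap (ContinuousLinearMap.fst ℝ E E)) (y, w) := by
  let L : (E [⋀^Fin n]→L[ℝ] ℝ) →L[ℝ] (E × E) [⋀^Fin n]→L[ℝ] ℝ :=
    ContinuousAlternatingMap.compContinuousLinearMapCLM (ContinuousLinearMap.fst ℝ E E)
  change DifferentiableAt ℝ (fun p : E × E => L (κ p.1 p.2)) (y, w)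
  exact L.differentiableAt.comp (y, w) (hasFDerivAt_clm_apply_snd hκ).differentiableAt

/-- The exterior derivative of the form `(y, w) ↦ κ y w` on a tangent bundle, contracted with a
vertical vector. -/
theorem extDeriv_vertical {κ : E → E →L[ℝ] E [⋀^Fin n]→L[ℝ] ℝ} {y w : E}
    (hκ : DifferentiableAt ℝ κ y) (c : E) (v : Fin n → E × E) :
    extDeriv (fun p : E × E => (κ p.1 p.2).compContinuousLinearMap (ContinuousLinearMap.fst ℝ E E))
      (y, w) (Fin.cons (0, c) v) = κ y c (fun i => (v i).1) := by
  have hd := hasFDerivAt_clm_apply_snd (w := w) hκ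
  have hdiff := differentiableAt_vertical (w := w) hκ
  -- Only the term differentiating along `(0, c)` survives. In the others that vector remains an
  -- argument of a form pulled back by the first projection.
  rw [extDeriv_apply hdiff, Fin.sum_univ_succ, Finset.sum_eq_zero, add_zero]
  · simp only [Fin.val_zero, pow_zero, one_smul, Fin.cons_zero]
    have h0 : ∀ p : E × E, (κ p.1 p.2).compContinuousLinearMap (ContinuousLinearMap.fst ℝ E E)
        (Fin.removeNth 0 (Fin.cons (0, c) v : Fin (n + 1) → E × E)) =
        κ p.1 p.2 (fun i => (v i).1) := fun p => by
      rw [Fin.removeNth_zero, Fin.tail_cons]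
      rfl
    simp only [h0]
    rw [(hd.continuousAlternatingMap_apply_const (fun i => (v i).1)).fderiv]
    simp
  · intro i _
    have h0 : ∀ p : E × E, (κ p.1 p.2).compContinuousLinearMap (ContinuousLinearMap.fst ℝ E E)
        (Fin.removeNth i.succ (Fin.cons (0, c) v : Fin (n + 1) → E × E)) = 0 := fun p => by
      obtain _ | n := n
      · exact i.elim0
      · rw [ContinuousAlternatingMap.compContinuousLinearMap_apply]
        refine ContinuousAlternatingMap.map_coord_zero _ (i := (0 : Fin (n + 1))) ?_
        simp [Fin.removeNth]
    simp [h0]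

variable {P : Type*} [NormedAddCommGroup P] [NormedSpace ℝ P] {s : Set P}

/-- The form is the pullback of `(y, w) ↦ κ y w` under `(f, h)`. As the derivative of `f` kills `ξ`,
the image of `ξ` is vertical, and naturality of the exterior derivative reduces the claim to
`extDeriv_vertical`. -/
theorem extDerivWithin_apply_cons_of_map_eq_zero {κ : E → E →L[ℝ] E [⋀^Fin n]→L[ℝ] ℝ}
    {f h : P → E} {x : P}
    (hs : UniqueDiffOn ℝ s) (hxc : x ∈ closure (interior s)) (hx : x ∈ s)
    (hκ : DifferentiableAt ℝ κ (f x))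
    (hf : ContDiffWithinAt ℝ ∞ f s x) (hh : ContDiffWithinAt ℝ ∞ h s x) {ξ : P}
    (hξ : fderivWithin ℝ f s x ξ = 0) (v : Fin n → P) :
    extDerivWithin (fun z => (κ (f z) (h z)).compContinuousLinearMap (fderivWithin ℝ f s z)) s x
      (Fin.cons ξ v) =
      κ (f x) (fderivWithin ℝ h s x ξ) (fun i => fderivWithin ℝ f s x (v i)) := by
  let Ω : E × E → (E × E) [⋀^Fin n]→L[ℝ] ℝ := fun p =>
    (κ p.1 p.2).compContinuousLinearMap (ContinuousLinearMap.fst ℝ E E)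
  have hΩ : DifferentiableAt ℝ Ω (f x, h x) := differentiableAt_vertical hκ
  have hF : ContDiffWithinAt ℝ 2 (fun z => (f z, h z)) s x :=
    (hf.prodMk hh).of_le ENat.LEInfty.out
  have hfd : ∀ {z}, z ∈ s → DifferentiableWithinAt ℝ f s z → DifferentiableWithinAt ℝ h s z →
      fderivWithin ℝ (fun z => (f z, h z)) s z =
        (fderivWithin ℝ f s z).prod (fderivWithin ℝ h s z) := fun {z} hz h1 h2 =>
    DifferentiableWithinAt.fderivWithin_prodMk h1 h2 (hs z hz)
  have hev : (fun z => (κ (f z) (h z)).compContinuousLinearMap (fderivWithin ℝ f s z)) =ᶠ[𝓝[s] x]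
      fun z => (Ω (f z, h z)).compContinuousLinearMap
        (fderivWithin ℝ (fun z => (f z, h z)) s z) := by
    have h1 := (hf.of_le (m := 1) ENat.LEInfty.out).eventually (by simp)
    have h2 := (hh.of_le (m := 1) ENat.LEInfty.out).eventually (by simp)
    rw [insert_eq_of_mem hx] at h1 h2
    filter_upwards [h1, h2, self_mem_nhdsWithin] with z hz1 hz2 hz
    rw [hfd hz (hz1.differentiableWithinAt (by simp)) (hz2.differentiableWithinAt (by simp))]
    ext w
    rfl
  have hfx := hfd hx (hf.differentiableWithinAt (by simp)) (hh.differentiableWithinAt (by simp))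
  have hpull : extDerivWithin (fun z => (Ω (f z, h z)).compContinuousLinearMap
      (fderivWithin ℝ (fun z => (f z, h z)) s z)) s x =
      (extDerivWithin Ω univ (f x, h x)).compContinuousLinearMap
        (fderivWithin ℝ (fun z => (f z, h z)) s x) :=
    extDerivWithin_pullback hΩ.differentiableWithinAt hF (by simp) hs hxc hx (mapsTo_univ _ _)
  rw [hev.extDerivWithin_eq_of_mem hx, hpull, extDerivWithin_univ, hfx,
    ContinuousAlternatingMap.compContinuousLinearMap_apply]
  have hcons : (⇑((fderivWithin ℝ f s x).prod (fderivWithin ℝ h s x)) ∘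
      (Fin.cons ξ v : Fin (n + 1) → P)) = (Fin.cons (0, fderivWithin ℝ h s x ξ)
        (fun i => (fderivWithin ℝ f s x (v i), fderivWithin ℝ h s x (v i))) :
          Fin (n + 1) → E × E) := by
    ext1 i
    refine Fin.cases ?_ (fun j => ?_) i
    · simp [hξ]
    · simp
  rw [hcons]
  exact extDeriv_vertical hκ _ _

end Transgression

/-! ### The transgression identity -/

section Transgression

open Filter Topology Set

set_option synthInstance.maxHeartbeats 400000

theorem ContDiffWithinAt.comp_section {P V : Type*} [NormedAddCommGroup P] [NormedSpace ℝ P]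
    [NormedAddCommGroup V] [NormedSpace ℝ V] {s : Set P} {f : P × ℝ → V} {x : P} {θ : ℝ}
    (hf : ContDiffWithinAt ℝ ∞ f (s ×ˢ univ) (x, θ)) :
    ContDiffWithinAt ℝ ∞ (fun z => f (z, θ)) s x :=
  ContDiffWithinAt.comp (t := s ×ˢ univ) x hf
    (contDiffWithinAt_id.prodMk contDiffWithinAt_const) fun _ hz => ⟨hz, mem_univ _⟩

theorem hasDerivAt_section {P V : Type*} [NormedAddCommGroup P] [NormedSpace ℝ P]
    [NormedAddCommGroup V] [NormedSpace ℝ V] {s : Set P} {f : P × ℝ → V} {x : P} {θ : ℝ}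
    (hx : x ∈ s) (hf : DifferentiableWithinAt ℝ f (s ×ˢ univ) (x, θ)) :
    HasDerivAt (fun t => f (x, t)) (fderivWithin ℝ f (s ×ˢ univ) (x, θ) (0, 1)) θ := by
  have h1 : HasDerivWithinAt (fun t : ℝ => (x, t)) ((0 : P), (1 : ℝ)) univ θ :=
    ((hasDerivAt_const θ x).prodMk (hasDerivAt_id θ)).hasDerivWithinAt
  exact (HasFDerivWithinAt.comp_hasDerivWithinAt (t := s ×ˢ univ) θ hf.hasFDerivWithinAt h1
    fun t _ => ⟨hx, mem_univ t⟩).hasDerivAt univ_mem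

theorem fderivWithin_section {P V : Type*} [NormedAddCommGroup P] [NormedSpace ℝ P]
    [NormedAddCommGroup V] [NormedSpace ℝ V] {s : Set P} {f : P × ℝ → V} {x : P} {θ : ℝ}
    (hs : UniqueDiffWithinAt ℝ s x) (hf : DifferentiableWithinAt ℝ f (s ×ˢ univ) (x, θ)) :
    fderivWithin ℝ (fun z => f (z, θ)) s x =
      (fderivWithin ℝ f (s ×ˢ univ) (x, θ)).comp (ContinuousLinearMap.inl ℝ P ℝ) := by
  have h1 : HasFDerivWithinAt (fun z : P => (z, θ)) (ContinuousLinearMap.inl ℝ P ℝ) s x :=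
    (hasFDerivAt_prodMk_left x θ).hasFDerivWithinAt
  exact (HasFDerivWithinAt.comp (t := s ×ˢ univ) x hf.hasFDerivWithinAt h1
    fun z hz => ⟨hz, mem_univ θ⟩).fderivWithin hs

theorem eventually_section {P : Type*} [TopologicalSpace P] {s : Set P} {x : P} {θ : ℝ}
    {p : P × ℝ → Prop} (h : ∀ᶠ q in 𝓝[s ×ˢ univ] (x, θ), p q) : ∀ᶠ z in 𝓝[s] x, p (z, θ) := by
  have hc : Tendsto (fun z : P => (z, θ)) (𝓝[s] x) (𝓝[s ×ˢ univ] (x, θ)) :=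
    tendsto_nhdsWithin_of_tendsto_nhds_of_eventually_within _
      ((Continuous.prodMk_left θ).continuousAt.mono_left nhdsWithin_le_nhds)
      (by filter_upwards [self_mem_nhdsWithin] with z hz using ⟨hz, mem_univ θ⟩)
  exact hc.eventually h

theorem map_eq_zero_of_finrank_lt {E : Type*} [NormedAddCommGroup E] [NormedSpace ℝ E]
    [FiniteDimensional ℝ E] {m : ℕ} (hm : Module.finrank ℝ E < m) (η : E [⋀^Fin m]→L[ℝ] ℝ)
    (v : Fin m → E) : η v = 0 := by
  refine η.toAlternatingMap.map_linearDependent v fun h => ?_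
  have := h.fintype_card_le_finrank
  simp at this
  omega

variable {B E : Type*} [NormedAddCommGroup B] [NormedSpace ℝ B] [NormedAddCommGroup E]
  [NormedSpace ℝ E] [FiniteDimensional ℝ E] {n : ℕ}

/-- Transgression: if `κ` is preserved by the family of maps `u(s, ·, θ)`, then the exterior
derivative of the pullback of `κ(∂u/∂θ; ·)` is a derivative in `θ`. -/
theorem hasDerivAt_transgression (hn : Module.finrank ℝ E = n)
    {κ : E → E →L[ℝ] E [⋀^Fin n]→L[ℝ] ℝ} {u : (B × E) × ℝ → E} {s : Set (B × E)} {x : B × E}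
    {θ₀ : ℝ} (hs : UniqueDiffOn ℝ s) (hxc : x ∈ closure (interior s)) (hx : x ∈ s)
    (hu : ContDiffWithinAt ℝ ∞ u (s ×ˢ univ) (x, θ₀)) (hκ : DifferentiableAt ℝ κ (u (x, θ₀)))
    (hD : Function.Injective fun a : E => fderivWithin ℝ u (s ×ˢ univ) (x, θ₀) ((0, a), 0))
    {κ₀ : E →L[ℝ] E [⋀^Fin n]→L[ℝ] ℝ}
    (hinv : ∀ᶠ θ in 𝓝 θ₀, ∀ (a : E) (e : Fin n → E),
      κ (u (x, θ)) (fderivWithin ℝ u (s ×ˢ univ) (x, θ) ((0, a), 0))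
        (fun i => fderivWithin ℝ u (s ×ˢ univ) (x, θ) ((0, e i), 0)) = κ₀ a e)
    (b : B) (e : Fin n → E) :
    HasDerivAt (fun θ => κ (u (x, θ)) (fderivWithin ℝ u (s ×ˢ univ) (x, θ) ((b, 0), 0))
        (fun i => fderivWithin ℝ u (s ×ˢ univ) (x, θ) ((0, e i), 0)))
      (extDerivWithin (fun z => (κ (u (z, θ₀))
        (fderivWithin ℝ u (s ×ˢ univ) (z, θ₀) (0, 1))).compContinuousLinearMap
          ((fderivWithin ℝ u (s ×ˢ univ) (z, θ₀)).comp (ContinuousLinearMap.inl ℝ (B × E) ℝ))) s x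
            (Fin.cons (b, 0) (fun i => (0, e i)))) θ₀ := by
  set W : Set ((B × E) × ℝ) := s ×ˢ univ with hW
  set U := fderivWithin ℝ u W with hU
  have hWu : UniqueDiffOn ℝ W := hs.prod uniqueDiffOn_univ
  have hxW : ∀ θ, (x, θ) ∈ W := fun θ => ⟨hx, mem_univ θ⟩
  have hUc : ContDiffWithinAt ℝ ∞ U W (x, θ₀) := hu.fderivWithin_right hWu le_rfl (hxW θ₀)
  have hUd : DifferentiableWithinAt ℝ U W (x, θ₀) := hUc.differentiableWithinAt (by simp)
  set V := fderivWithin ℝ U W (x, θ₀) with hV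
  have hsymm : ∀ p q, V p q = V q p := by
    have hxcW : (x, θ₀) ∈ closure (interior W) := by
      rw [hW, interior_prod_eq, closure_prod_eq]
      exact ⟨hxc, by simp⟩
    exact fun p q => (hu.of_le (m := 2) ENat.LEInfty.out).isSymmSndFDerivWithinAt (by simp) hWu hxcW
      (hxW θ₀) p q
  have hUθ : HasDerivAt (fun θ => U (x, θ)) (V (0, 1)) θ₀ := hasDerivAt_section hx hUd
  -- the vector field `Y`
  let D : ℝ → E →L[ℝ] E := fun θ => (U (x, θ)).comp
    ((ContinuousLinearMap.inl ℝ (B × E) ℝ).comp (ContinuousLinearMap.inr ℝ B E))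
  let a : ℝ → E := fun θ => U (x, θ) ((b, 0), 0)
  have hDinv : (D θ₀).IsInvertible :=
    ⟨(LinearEquiv.ofInjectiveEndo (D θ₀).toLinearMap hD).toContinuousLinearEquiv, by ext; rfl⟩
  have hDd : HasDerivAt D ((V (0, 1)).comp
      ((ContinuousLinearMap.inl ℝ (B × E) ℝ).comp (ContinuousLinearMap.inr ℝ B E))) θ₀ := by
    have := hUθ.clm_comp (hasDerivAt_const θ₀
      ((ContinuousLinearMap.inl ℝ (B × E) ℝ).comp (ContinuousLinearMap.inr ℝ B E)))
    simpa using this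
  have had : HasDerivAt a (V (0, 1) ((b, 0), 0)) θ₀ := by
    have := hUθ.clm_apply (hasDerivAt_const θ₀ (((b, 0), 0) : (B × E) × ℝ))
    simpa using this
  -- The vector tangent to the slice whose image under `D` is the image of `(b, 0)`.
  let Y : ℝ → E := fun θ => (D θ).inverse (a θ)
  have hDev : ∀ᶠ θ in 𝓝 θ₀, (D θ).IsInvertible := by
    obtain ⟨L, hL⟩ := hDinv
    exact hDd.continuousAt.eventually (hL ▸ ContinuousLinearEquiv.nhds L)
  have hDY : ∀ᶠ θ in 𝓝 θ₀, D θ (Y θ) = a θ := by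
    filter_upwards [hDev] with θ hθ
    obtain ⟨L, hL⟩ := hθ
    simp [Y, ← hL]
  obtain ⟨Y', hY'⟩ : ∃ Y', HasDerivAt Y Y' θ₀ := by
    have h1 : DifferentiableAt ℝ (fun θ => (D θ).inverse) θ₀ :=
      ((hDinv.contDiffAt_map_inverse (n := 1)).differentiableAt (by simp)).comp θ₀
        hDd.differentiableAt
    exact ⟨_, (h1.clm_apply had.differentiableAt).hasDerivAt⟩
  -- Obtained by differentiating `D θ (Y θ) = a θ` at θ₀.
  have hderiv : V (0, 1) ((0, Y θ₀), 0) + D θ₀ Y' = V (0, 1) ((b, 0), 0) :=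
    ((hDd.clm_apply hY').congr_of_eventuallyEq (hDY.mono fun θ h => h.symm)).unique had
  -- Correcting `(b, 0)` by `Y` gives a vector in the kernel of the spatial derivative of `u`.
  let ξ : B × E := (b, -Y θ₀)
  have hsplit : ∀ L : (B × E) × ℝ →L[ℝ] E, L (ξ, 0) = L ((b, 0), 0) - L ((0, Y θ₀), 0) := by
    intro L
    rw [← map_sub]
    simp [ξ]
  have hξ0 : U (x, θ₀) (ξ, 0) = 0 := by
    rw [hsplit, sub_eq_zero]
    exact hDY.self_of_nhds.symm
  have hξ1 : V (ξ, 0) (0, 1) = D θ₀ Y' := by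
    rw [hsymm, hsplit, ← hderiv]
    abel
  -- the derivative of the function
  have hq : HasDerivAt (fun θ => κ (u (x, θ)) (U (x, θ) ((b, 0), 0))
      (fun i => U (x, θ) ((0, e i), 0))) (κ₀ Y' e) θ₀ := by
    -- By invariance the function is `κ₀ (Y θ) e`, where only `Y` depends on θ.
    have h1 : HasDerivAt (fun θ => κ₀ (Y θ) e) (κ₀ Y' e) θ₀ :=
      ((ContinuousAlternatingMap.apply ℝ E ℝ e).comp κ₀).hasFDerivAt.comp_hasDerivAt θ₀ hY'
    refine h1.congr_of_eventuallyEq ?_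
    filter_upwards [hinv, hDY] with θ hθ hθ'
    rw [← hθ (Y θ) e]
    exact congrArg (fun w => κ (u (x, θ)) w fun i => U (x, θ) ((0, e i), 0)) hθ'.symm
  -- the exterior derivative
  set α : B × E → (B × E) [⋀^Fin n]→L[ℝ] ℝ := fun z => (κ (u (z, θ₀))
        (U (z, θ₀) (0, 1))).compContinuousLinearMap
          ((U (z, θ₀)).comp (ContinuousLinearMap.inl ℝ (B × E) ℝ)) with hα
  have hud : ∀ᶠ q in 𝓝[W] (x, θ₀), DifferentiableWithinAt ℝ u W q := by
    have h1 := (hu.of_le (m := 1) ENat.LEInfty.out).eventually (by simp)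
    rw [insert_eq_of_mem (hxW θ₀)] at h1
    filter_upwards [h1] with q hq using hq.differentiableWithinAt (by simp)
  have hαev : α =ᶠ[𝓝[s] x] fun z => (κ (u (z, θ₀)) (U (z, θ₀) (0, 1))).compContinuousLinearMap
      (fderivWithin ℝ (fun z => u (z, θ₀)) s z) := by
    filter_upwards [eventually_section hud, self_mem_nhdsWithin] with z hz hzs
    rw [fderivWithin_section (hs z hzs) hz]
  have hfx := fderivWithin_section (hs x hx) (hu.differentiableWithinAt (by simp) :
    DifferentiableWithinAt ℝ u (s ×ˢ univ) (x, θ₀))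
  have hhx : fderivWithin ℝ (fun z => U (z, θ₀) (0, 1)) s x ξ = V (ξ, 0) (0, 1) := by
    have h1 := fderivWithin_section (hs x hx) hUd
    have h2 : DifferentiableWithinAt ℝ (fun z => U (z, θ₀)) s x :=
      (ContDiffWithinAt.comp_section hUc).differentiableWithinAt (by simp)
    rw [fderivWithin_clm_apply (hs x hx) h2 (differentiableWithinAt_const _), h1]
    simp [hV, hW]
  have hext1 : extDerivWithin α s x (Fin.cons ξ (fun i => (0, e i))) = κ₀ Y' e := by
    rw [hαev.extDerivWithin_eq_of_mem hx]
    refine (extDerivWithin_apply_cons_of_map_eq_zero (f := fun z => u (z, θ₀))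
      (h := fun z => U (z, θ₀) (0, 1)) hs hxc hx hκ (ContDiffWithinAt.comp_section hu)
      ((ContDiffWithinAt.comp_section hUc).clm_apply contDiffWithinAt_const) ?_ _).trans ?_
    · rw [hfx]
      exact hξ0
    · rw [hfx, hhx, hξ1]
      exact hinv.self_of_nhds Y' e
  -- All n + 1 arguments lie in the factor `E`, which has dimension n.
  have hext2 : extDerivWithin α s x (Fin.cons (0, Y θ₀) (fun i => (0, e i))) = 0 := by
    have h1 := map_eq_zero_of_finrank_lt (E := E) (m := n + 1) (by omega)
      ((extDerivWithin α s x).compContinuousLinearMap (ContinuousLinearMap.inr ℝ B E))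
      (Fin.cons (Y θ₀) e)
    rw [← h1, ContinuousAlternatingMap.compContinuousLinearMap_apply]
    congr 1
    ext1 i
    refine Fin.cases ?_ (fun j => ?_) i <;> simp
  have hext : extDerivWithin α s x (Fin.cons (b, 0) (fun i => (0, e i))) = κ₀ Y' e := by
    have h1 := (extDerivWithin α s x).toMultilinearMap.cons_add (fun i => (0, e i)) ξ (0, Y θ₀)
    have h2 : ξ + (0, Y θ₀) = (b, 0) := by simp [ξ]
    rw [h2] at h1
    refine h1.trans ?_
    exact (congrArg₂ (· + ·) hext1 hext2).trans (add_zero _)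
  rw [hext]
  exact hq

end Transgression

/-! ### The homotopy in coordinates on the cylinder -/

section Cylinder

open Filter Topology Set

variable {n : ℕ} {M : Type*} [TopologicalSpace M] [ChartedSpace (Euc n) M]
  [IsManifold (𝓡 n) ∞ M]

/-- The map `[0,1] × M × ℝ → M`, `(p, θ) ↦ F(p₁, e^{iθ}, p₂)`, read in the chart of `[0,1] × M`
around `p₀`. -/
noncomputable def cylMap (F : unitInterval × Circle × M → M) (p₀ : unitInterval × M)
    (q : (Euc 1 × Euc n) × ℝ) : M :=
  F (((extChartAt (cylModel n) p₀).symm q.1).1, Circle.exp q.2,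
    ((extChartAt (cylModel n) p₀).symm q.1).2)

variable {F : unitInterval × Circle × M → M} (p₀ : unitInterval × M)

theorem contMDiffOn_cylMap (hF : IsSmoothHomotopy n F) :
    ContMDiffOn 𝓘(ℝ, (Euc 1 × Euc n) × ℝ) (𝓡 n) ∞ (cylMap F p₀)
    ((extChartAt (cylModel n) p₀).target ×ˢ univ) := by
  have h1 : ContMDiffOn 𝓘(ℝ, (Euc 1 × Euc n) × ℝ) (cylModel n) ∞
      (fun q : (Euc 1 × Euc n) × ℝ => (extChartAt (cylModel n) p₀).symm q.1)
      ((extChartAt (cylModel n) p₀).target ×ˢ univ) :=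
    (contMDiffOn_extChartAt_symm (n := ∞) p₀).comp contDiff_fst.contMDiff.contMDiffOn
      fun q hq => hq.1
  have h2 : ContMDiff 𝓘(ℝ, (Euc 1 × Euc n) × ℝ) (𝓡 1) ∞
      (fun q : (Euc 1 × Euc n) × ℝ => Circle.exp q.2) :=
    contMDiff_circleExp.comp contDiff_snd.contMDiff
  exact ContMDiff.comp_contMDiffOn hF
    ((contMDiff_fst.comp_contMDiffOn h1).prodMk (h2.contMDiffOn.prodMk
      (contMDiff_snd.comp_contMDiffOn h1)))

/-- `cylMap` read in the chart of `M` around `c`. -/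
noncomputable def cylCoord (F : unitInterval × Circle × M → M) (p₀ : unitInterval × M) (c : M)
    (q : (Euc 1 × Euc n) × ℝ) : Euc n := extChartAt (𝓡 n) c (cylMap F p₀ q)

theorem contDiffWithinAt_cylCoord (hF : IsSmoothHomotopy n F) {c : M} {q : (Euc 1 × Euc n) × ℝ}
    (hq : q ∈ (extChartAt (cylModel n) p₀).target ×ˢ (univ : Set ℝ))
    (hc : cylMap F p₀ q ∈ (extChartAt (𝓡 n) c).source) :
    ContDiffWithinAt ℝ ∞ (cylCoord F p₀ c) ((extChartAt (cylModel n) p₀).target ×ˢ univ) q := by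
  have h1 : ContMDiffAt (𝓡 n) 𝓘(ℝ, Euc n) ∞ (extChartAt (𝓡 n) c) (cylMap F p₀ q) :=
    contMDiffAt_extChartAt' (by rwa [← extChartAt_source (𝓡 n)])
  exact (h1.comp_contMDiffWithinAt q (contMDiffOn_cylMap p₀ hF q hq)).contDiffWithinAt

theorem uniqueDiffOn_cyl_target {M : Type*} [TopologicalSpace M] [ChartedSpace (Euc n) M]
    (p₀ : unitInterval × M) : UniqueDiffOn ℝ (extChartAt (cylModel n) p₀).target :=
  uniqueDiffOn_extChartAt_target p₀

theorem cylCoord_fderivWithin_zero_one (hF : IsSmoothHomotopy n F) {c : M}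
    {x : Euc 1 × Euc n} {θ : ℝ}
    (hx : x ∈ (extChartAt (cylModel n) p₀).target)
    (hc : cylMap F p₀ (x, θ) ∈ (extChartAt (𝓡 n) c).source) :
    fderivWithin ℝ (cylCoord F p₀ c) ((extChartAt (cylModel n) p₀).target ×ˢ univ) (x, θ) (0, 1) =
      mfderiv (𝓡 n) 𝓘(ℝ, Euc n) (extChartAt (𝓡 n) c) (cylMap F p₀ (x, θ))
        (velocity (loopMap hF ((extChartAt (cylModel n) p₀).symm x)) θ) := by
  have h1 := hasDerivAt_section (f := cylCoord F p₀ c) hx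
    ((contDiffWithinAt_cylCoord p₀ hF ⟨hx, mem_univ θ⟩ hc).differentiableWithinAt (by simp))
  have h2 : ContMDiffAt (𝓡 n) 𝓘(ℝ, Euc n) ∞ (extChartAt (𝓡 n) c) (cylMap F p₀ (x, θ)) :=
    contMDiffAt_extChartAt' (by rwa [← extChartAt_source (𝓡 n)])
  have h3 : ContMDiff 𝓘(ℝ, ℝ) (𝓡 n) ∞
      (fun s : ℝ => loopMap hF ((extChartAt (cylModel n) p₀).symm x) (Circle.exp s)) :=
    (loopMap hF ((extChartAt (cylModel n) p₀).symm x)).contMDiff.comp contMDiff_circleExp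
  have h4 := (h2.mdifferentiableAt (by simp)).hasMFDerivAt.comp θ
    ((h3.mdifferentiable (by simp) θ).hasMFDerivAt)
  let D : ℝ →L[ℝ] Euc n := (mfderiv (𝓡 n) 𝓘(ℝ, Euc n) (extChartAt (𝓡 n) c)
    (cylMap F p₀ (x, θ))).comp (mfderiv 𝓘(ℝ, ℝ) (𝓡 n)
      (fun s : ℝ => loopMap hF ((extChartAt (cylModel n) p₀).symm x) (Circle.exp s)) θ)
  have h5 : HasFDerivAt (fun t => cylCoord F p₀ c (x, t)) D θ := h4.hasFDerivAt
  exact h1.unique h5.hasDerivAt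

theorem cylCoord_fderivWithin_inl (hF : IsSmoothHomotopy n F) {c : M}
    {x : Euc 1 × Euc n} {θ : ℝ}
    (hx : x ∈ (extChartAt (cylModel n) p₀).target)
    (hc : cylMap F p₀ (x, θ) ∈ (extChartAt (𝓡 n) c).source) (v : Euc 1 × Euc n) :
    fderivWithin ℝ (cylCoord F p₀ c) ((extChartAt (cylModel n) p₀).target ×ˢ univ) (x, θ) (v, 0) =
      mfderiv (𝓡 n) 𝓘(ℝ, Euc n) (extChartAt (𝓡 n) c) (cylMap F p₀ (x, θ))
        (mfderiv (cylModel n) (𝓡 n) (fun p => loopMap hF p (Circle.exp θ))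
          ((extChartAt (cylModel n) p₀).symm x)
          (mfderivWithin 𝓘(ℝ, Euc 1 × Euc n) (cylModel n) (extChartAt (cylModel n) p₀).symm
            (range (cylModel n)) x v)) := by
  have h2 : ContMDiffAt (𝓡 n) 𝓘(ℝ, Euc n) ∞ (extChartAt (𝓡 n) c) (cylMap F p₀ (x, θ)) :=
    contMDiffAt_extChartAt' (by rwa [← extChartAt_source (𝓡 n)])
  have h3 : ContMDiff (cylModel n) (𝓡 n) ∞ (fun p => loopMap hF p (Circle.exp θ)) :=
    hF.comp (contMDiff_fst.prodMk (contMDiff_const.prodMk contMDiff_snd))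
  have h4 : HasMFDerivWithinAt 𝓘(ℝ, Euc 1 × Euc n) (cylModel n) (extChartAt (cylModel n) p₀).symm
      (extChartAt (cylModel n) p₀).target x _ :=
    (mdifferentiableWithinAt_extChartAt_symm hx).hasMFDerivWithinAt.mono
      (extChartAt_target_subset_range p₀)
  have h5 := (h2.mdifferentiableAt (by simp)).hasMFDerivAt.comp_hasMFDerivWithinAt x
    ((h3.mdifferentiable (by simp) ((extChartAt (cylModel n) p₀).symm x)).hasMFDerivAt.comp_hasMFDerivWithinAt x
      h4)
  let D : Euc 1 × Euc n →L[ℝ] Euc n := (mfderiv (𝓡 n) 𝓘(ℝ, Euc n) (extChartAt (𝓡 n) c)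
    (cylMap F p₀ (x, θ))).comp ((mfderiv (cylModel n) (𝓡 n) (fun p => loopMap hF p (Circle.exp θ))
          ((extChartAt (cylModel n) p₀).symm x)).comp
          (mfderivWithin 𝓘(ℝ, Euc 1 × Euc n) (cylModel n) (extChartAt (cylModel n) p₀).symm
            (range (cylModel n)) x))
  have h6 : HasFDerivWithinAt (fun z => cylCoord F p₀ c (z, θ)) D
    (extChartAt (cylModel n) p₀).target x := h5.hasFDerivWithinAt
  have h7 := fderivWithin_section (uniqueDiffOn_cyl_target p₀ x hx)
    ((contDiffWithinAt_cylCoord p₀ hF ⟨hx, mem_univ θ⟩ hc).differentiableWithinAt (by simp))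
  rw [h6.fderivWithin (uniqueDiffOn_cyl_target p₀ x hx)] at h7
  exact congrArg (fun L : Euc 1 × Euc n →L[ℝ] Euc n => L v) h7.symm

theorem eventually_cylMap_mem_source (hF : IsSmoothHomotopy n F) {q : (Euc 1 × Euc n) × ℝ}
    (hq : q ∈ (extChartAt (cylModel n) p₀).target ×ˢ (univ : Set ℝ)) :
    ∀ᶠ q' in 𝓝[(extChartAt (cylModel n) p₀).target ×ˢ univ] q,
      cylMap F p₀ q' ∈ (extChartAt (𝓡 n) (cylMap F p₀ q)).source :=
  (contMDiffOn_cylMap p₀ hF q hq).continuousWithinAt.eventually_mem (extChartAt_source_mem_nhds _)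

end Cylinder

/-! ### The integrand and the pulled-back form: smoothness -/

section LoopForm

open Filter Topology Set

variable {k : ℕ} [NeZero k] {M : Type*} [TopologicalSpace M] [ChartedSpace (Euc (2 * k - 1)) M]
  [IsManifold (𝓡 (2 * k - 1)) ∞ M] (g : RiemMetric (2 * k - 1) M)
  {F : unitInterval × Circle × M → M} (hF : IsSmoothHomotopy (2 * k - 1) F)

/-- The integrand of the pullback of the Wodzicki-Chern-Simons form to `[0,1] × M`. -/
noncomputable def loopForm (θ : ℝ) (p : unitInterval × M) :
    (Euc 1 × Euc (2 * k - 1)) [⋀^Fin (2 * k - 1)]→L[ℝ] ℝ :=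
  let L : Euc 1 × Euc (2 * k - 1) →L[ℝ] Euc (2 * k - 1) :=
    mfderiv (cylModel (2 * k - 1)) (𝓡 (2 * k - 1)) (fun q => loopMap hF q (Circle.exp θ)) p
  let w : Euc (2 * k - 1) := velocity (loopMap hF p) θ
  (curvForm k (curvAt g (loopMap hF p (Circle.exp θ))) w).compContinuousLinearMap L

theorem loopForm_apply (θ : ℝ) (p : unitInterval × M)
    (V : Fin (2 * k - 1) → TangentSpace (cylModel (2 * k - 1)) p) :
    loopForm g hF θ p V = kTensor g (loopMap hF p (Circle.exp θ)) (velocity (loopMap hF p) θ)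
      (fun i => mfderiv (cylModel (2 * k - 1)) (𝓡 (2 * k - 1))
        (fun q => loopMap hF q (Circle.exp θ)) p (V i)) :=
  (curvForm_apply _ _ _).trans (kTensor_eq_curvSum g _ _ _).symm

/-- `loopForm` in the chart around `p₀`. -/
noncomputable def chartForm (p₀ : unitInterval × M) (q : (Euc 1 × Euc (2 * k - 1)) × ℝ) :
    (Euc 1 × Euc (2 * k - 1)) [⋀^Fin (2 * k - 1)]→L[ℝ] ℝ :=
  formInChart (cylModel (2 * k - 1)) (fun p => loopForm g hF q.2 p) p₀ q.1

variable (p₀ : unitInterval × M)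

/-- `loopForm` in the chart around `p₀` of `[0,1] × M` and the chart around `c` of `M`. -/
noncomputable def coordForm (g : RiemMetric (2 * k - 1) M) (F : unitInterval × Circle × M → M)
    (p₀ : unitInterval × M) (c : M) (q : (Euc 1 × Euc (2 * k - 1)) × ℝ) :
    (Euc 1 × Euc (2 * k - 1)) [⋀^Fin (2 * k - 1)]→L[ℝ] ℝ :=
    (curvForm k (chartCurv (metricInChart g c) (cylCoord F p₀ c q))
      (fderivWithin ℝ (cylCoord F p₀ c)
        ((extChartAt (cylModel (2 * k - 1)) p₀).target ×ˢ univ) q (0, 1))).compContinuousLinearMap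
      ((fderivWithin ℝ (cylCoord F p₀ c)
        ((extChartAt (cylModel (2 * k - 1)) p₀).target ×ˢ univ) q).comp
          (ContinuousLinearMap.inl ℝ (Euc 1 × Euc (2 * k - 1)) ℝ))

/-- The definition of K at a point uses the chart preferred there, which may jump as the point
moves. Chart independence replaces it by the fixed chart around `c`, where the dependence on `q` is
visibly smooth. -/
theorem chartForm_eq {c : M} {q : (Euc 1 × Euc (2 * k - 1)) × ℝ}
    (hq : q ∈ (extChartAt (cylModel (2 * k - 1)) p₀).target ×ˢ (univ : Set ℝ))
    (hc : cylMap F p₀ q ∈ (extChartAt (𝓡 (2 * k - 1)) c).source) :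
    chartForm g hF p₀ q = coordForm g F p₀ c q := by
  obtain ⟨x, θ⟩ := q
  ext V
  have h1 : chartForm g hF p₀ (x, θ) V = _ := (loopForm_apply g hF θ
    ((extChartAt (cylModel (2 * k - 1)) p₀).symm x) (fun i =>
      mfderivWithin 𝓘(ℝ, Euc 1 × Euc (2 * k - 1)) (cylModel (2 * k - 1))
        (extChartAt (cylModel (2 * k - 1)) p₀).symm (range (cylModel (2 * k - 1))) x (V i))).trans
    (kTensor_eq_curvSum_of_mem_source g _ c hc _ _)
  rw [h1, coordForm, ContinuousAlternatingMap.compContinuousLinearMap_apply, curvForm_apply,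
    cylCoord_fderivWithin_zero_one p₀ hF hq.1 hc]
  refine congrArg (curvSum k _ _) (funext fun i => ?_)
  exact (cylCoord_fderivWithin_inl p₀ hF hq.1 hc (V i)).symm

theorem contDiffAt_curvForm_chartCurv (c : M) {y : Euc (2 * k - 1)}
    (hy : y ∈ (extChartAt (𝓡 (2 * k - 1)) c).target) :
    ContDiffAt ℝ ∞ (fun z => curvForm k (chartCurv (metricInChart g c) z)) y := by
  refine contDiffAt_clm_of_apply fun w => contDiffWithinAt_alternating_of_apply fun X => ?_
  simp only [curvForm_apply]
  exact ContDiffWithinAt.curvSum (fun u v w => contDiffAt_chartCurv_metricInChart g c hy u v w)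
    contDiffWithinAt_const fun i => contDiffWithinAt_const

theorem contDiffOn_chartForm : ContDiffOn ℝ ∞ (chartForm g hF p₀)
    ((extChartAt (cylModel (2 * k - 1)) p₀).target ×ˢ univ) := by
  intro q hq
  set W := (extChartAt (cylModel (2 * k - 1)) p₀).target ×ˢ (univ : Set ℝ) with hW
  set c := cylMap F p₀ q with hc
  have hcs : cylMap F p₀ q ∈ (extChartAt (𝓡 (2 * k - 1)) c).source := mem_extChartAt_source c
  have hu := contDiffWithinAt_cylCoord p₀ hF hq hcs
  have hWu : UniqueDiffOn ℝ W := (uniqueDiffOn_cyl_target p₀).prod uniqueDiffOn_univ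
  have hU : ContDiffWithinAt ℝ ∞ (fderivWithin ℝ (cylCoord F p₀ c) W) W q :=
    hu.fderivWithin_right hWu le_rfl hq
  have hev : ∀ᶠ q' in 𝓝[W] q, chartForm g hF p₀ q' = coordForm g F p₀ c q' := by
    filter_upwards [eventually_cylMap_mem_source p₀ hF hq, self_mem_nhdsWithin] with q' h1 h2
    exact chartForm_eq g hF p₀ h2 h1
  refine ContDiffWithinAt.congr_of_eventuallyEq ?_ hev (chartForm_eq g hF p₀ hq hcs)
  refine contDiffWithinAt_alternating_of_apply fun V => ?_
  simp only [coordForm, ContinuousAlternatingMap.compContinuousLinearMap_apply, curvForm_apply]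
  have hy : cylCoord F p₀ c q ∈ (extChartAt (𝓡 (2 * k - 1)) c).target :=
    (extChartAt (𝓡 (2 * k - 1)) c).map_source hcs
  refine ContDiffWithinAt.curvSum (fun u v w => ?_) (hU.clm_apply contDiffWithinAt_const)
    fun i => hU.clm_apply contDiffWithinAt_const
  exact (contDiffAt_chartCurv_metricInChart g c hy u v w).comp_contDiffWithinAt q hu

theorem chartForm_extChartAt_self (θ : ℝ) :
    chartForm g hF p₀ (extChartAt (cylModel (2 * k - 1)) p₀ p₀, θ) = loopForm g hF θ p₀ := by
  have : IsManifold (𝓡 (2 * k - 1)) 1 M := IsManifold.of_le (n := ∞) ENat.LEInfty.out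
  have hid : mfderivWithin 𝓘(ℝ, Euc 1 × Euc (2 * k - 1)) (cylModel (2 * k - 1))
      (extChartAt (cylModel (2 * k - 1)) p₀).symm (range (cylModel (2 * k - 1)))
      (extChartAt (cylModel (2 * k - 1)) p₀ p₀) = ContinuousLinearMap.id ℝ _ :=
    mfderivWithin_range_extChartAt_symm
  ext V
  have hp : ∀ p, p = p₀ → loopForm g hF θ p V = loopForm g hF θ p₀ V := by
    rintro _ rfl
    rfl
  refine Eq.trans ?_ (hp _ (extChartAt_to_inv (I := cylModel (2 * k - 1)) p₀))
  exact congrArg (fun L : Euc 1 × Euc (2 * k - 1) →L[ℝ] Euc 1 × Euc (2 * k - 1) =>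
    loopForm g hF θ ((extChartAt (cylModel (2 * k - 1)) p₀).symm
      (extChartAt (cylModel (2 * k - 1)) p₀ p₀)) (fun i => L (V i))) hid

theorem continuous_loopForm (p : unitInterval × M) : Continuous fun θ => loopForm g hF θ p := by
  have h := continuous_section_of_continuousOn (contDiffOn_chartForm g hF p).continuousOn
    (mem_extChartAt_target (I := cylModel (2 * k - 1)) p)
  simpa only [chartForm_extChartAt_self] using h

/-- The pullback of the Wodzicki-Chern-Simons form to `[0,1] × M`. -/
noncomputable def pullbackForm (p : unitInterval × M) :
    (Euc 1 × Euc (2 * k - 1)) [⋀^Fin (2 * k - 1)]→L[ℝ] ℝ :=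
  ∫ θ in (0 : ℝ)..(2 * Real.pi), loopForm g hF θ p

theorem pullbackForm_apply (p : unitInterval × M)
    (V : Fin (2 * k - 1) → TangentSpace (cylModel (2 * k - 1)) p) :
    pullbackForm g hF p V =
      wodzickiCS g (loopMap hF p) (fun i => loopMapDeriv hF p (V i)) := by
  have h := (ContinuousAlternatingMap.apply ℝ (Euc 1 × Euc (2 * k - 1)) ℝ
    V).intervalIntegral_comp_comm ((continuous_loopForm g hF p).intervalIntegrable
      (μ := MeasureTheory.volume) 0 (2 * Real.pi))
  refine h.symm.trans ?_
  exact intervalIntegral.integral_congr fun θ _ => loopForm_apply g hF θ p V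

theorem formInChart_pullbackForm (x : Euc 1 × Euc (2 * k - 1)) :
    formInChart (cylModel (2 * k - 1)) (pullbackForm g hF) p₀ x =
      ∫ θ in (0 : ℝ)..(2 * Real.pi), chartForm g hF p₀ (x, θ) := by
  let D : Euc 1 × Euc (2 * k - 1) →L[ℝ] Euc 1 × Euc (2 * k - 1) :=
    mfderivWithin 𝓘(ℝ, Euc 1 × Euc (2 * k - 1)) (cylModel (2 * k - 1))
      (extChartAt (cylModel (2 * k - 1)) p₀).symm (range (cylModel (2 * k - 1))) x
  let L : ((Euc 1 × Euc (2 * k - 1)) [⋀^Fin (2 * k - 1)]→L[ℝ] ℝ) →L[ℝ]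
      (Euc 1 × Euc (2 * k - 1)) [⋀^Fin (2 * k - 1)]→L[ℝ] ℝ :=
    ContinuousAlternatingMap.compContinuousLinearMapCLM D
  exact (L.intervalIntegral_comp_comm ((continuous_loopForm g hF
      ((extChartAt (cylModel (2 * k - 1)) p₀).symm x)).intervalIntegrable
      (μ := MeasureTheory.volume) 0 (2 * Real.pi))).symm

/-- Near each of its points the chart target coincides with the range of the model with corners,
which is convex. -/
theorem exists_convex_cyl_target {n : ℕ} {M : Type*} [TopologicalSpace M] [ChartedSpace (Euc n) M]
    (p₀ : unitInterval × M) {x : Euc 1 × Euc n} (hx : x ∈ (extChartAt (cylModel n) p₀).target) :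
    ∃ ε > 0, Convex ℝ ((extChartAt (cylModel n) p₀).target ∩ Metric.ball x ε) := by
  have h := extChartAt_target_mem_nhdsWithin_of_mem hx
  obtain ⟨ε, hε, hsub⟩ := Metric.mem_nhdsWithin_iff.1 h
  refine ⟨ε, hε, ?_⟩
  have heq : (extChartAt (cylModel n) p₀).target ∩ Metric.ball x ε =
      range (cylModel n) ∩ Metric.ball x ε := by
    ext z
    exact ⟨fun hz => ⟨extChartAt_target_subset_range p₀ hz.1, hz.2⟩,
      fun hz => ⟨hsub ⟨hz.2, hz.1⟩, hz.2⟩⟩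
  rw [heq]
  exact (cylModel n).convex_range.inter (convex_ball x ε)

theorem isSmoothForm_pullbackForm :
    IsSmoothForm (cylModel (2 * k - 1)) (pullbackForm g hF) := by
  intro p₀
  refine (contDiffOn_intervalIntegral (uniqueDiffOn_cyl_target p₀)
    (fun x hx => exists_convex_cyl_target p₀ hx) (contDiffOn_chartForm g hF p₀)
    (a := 0) (b := 2 * Real.pi)).congr fun x _ => ?_
  exact formInChart_pullbackForm g hF p₀ x

end LoopForm

/-! ### Derivatives at the centre of the cylinder chart -/

section Basepoint

open Filter Topology Set

variable {n : ℕ} {M : Type*} [TopologicalSpace M] [ChartedSpace (Euc n) M]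
  {F : unitInterval × Circle × M → M} (p₀ : unitInterval × M)

theorem cylMap_extChartAt_self (hF : IsSmoothHomotopy n F) (θ : ℝ) :
    cylMap F p₀ (extChartAt (cylModel n) p₀ p₀, θ) = loopMap hF p₀ (Circle.exp θ) := by
  simp only [cylMap, extChartAt_to_inv]
  rfl

theorem contMDiff_slice (hF : IsSmoothHomotopy n F) (t : unitInterval) (z : Circle) :
    ContMDiff (𝓡 n) (𝓡 n) ∞ (fun m => F (t, z, m)) :=
  ContMDiff.comp hF (contMDiff_const.prodMk (contMDiff_const.prodMk contMDiff_id))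

theorem mfderiv_loopMap_zero (hF : IsSmoothHomotopy n F) (z : Circle) (a : Euc n) :
    (mfderiv (cylModel n) (𝓡 n) (fun p => loopMap hF p z) p₀ ((0, a) : Euc 1 × Euc n) : Euc n) =
      mfderiv (𝓡 n) (𝓡 n) (fun m => F (p₀.1, z, m)) p₀.2 a := by
  have h3 : ContMDiff (cylModel n) (𝓡 n) ∞ (fun p => loopMap hF p z) :=
    hF.comp (contMDiff_fst.prodMk (contMDiff_const.prodMk contMDiff_snd))
  have h1 : HasMFDerivAt (𝓡 n) (cylModel n) (fun m : M => (p₀.1, m)) p₀.2 _ :=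
    (hasMFDerivAt_const p₀.1 p₀.2).prodMk (hasMFDerivAt_id p₀.2)
  have h2 := ((h3.mdifferentiable (by simp) p₀).hasMFDerivAt.comp p₀.2 h1).mfderiv
  exact (congrArg (fun L : Euc n →L[ℝ] Euc n => L a) h2).symm

theorem eventually_loopMap_mem_source (hF : IsSmoothHomotopy n F) (θ₀ : ℝ) :
    ∀ᶠ θ in 𝓝 θ₀, loopMap hF p₀ (Circle.exp θ) ∈
      (extChartAt (𝓡 n) (loopMap hF p₀ (Circle.exp θ₀))).source := by
  have hcont : Continuous fun θ : ℝ => loopMap hF p₀ (Circle.exp θ) :=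
    (loopMap hF p₀).contMDiff.continuous.comp Circle.exp.continuous
  exact hcont.continuousAt.eventually_mem (extChartAt_source_mem_nhds _)

variable [IsManifold (𝓡 n) ∞ M]

theorem cylCoord_fderivWithin_inl_self (hF : IsSmoothHomotopy n F) {c : M} {θ : ℝ}
    (hc : loopMap hF p₀ (Circle.exp θ) ∈ (extChartAt (𝓡 n) c).source) (v : Euc 1 × Euc n) :
    fderivWithin ℝ (cylCoord F p₀ c) ((extChartAt (cylModel n) p₀).target ×ˢ univ)
      (extChartAt (cylModel n) p₀ p₀, θ) (v, 0) =
      mfderiv (𝓡 n) 𝓘(ℝ, Euc n) (extChartAt (𝓡 n) c) (loopMap hF p₀ (Circle.exp θ))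
        (mfderiv (cylModel n) (𝓡 n) (fun p => loopMap hF p (Circle.exp θ)) p₀ v) := by
  have : IsManifold (𝓡 n) 1 M := IsManifold.of_le (n := ∞) ENat.LEInfty.out
  have h := cylCoord_fderivWithin_inl p₀ hF (mem_extChartAt_target (I := cylModel n) p₀)
    (by rwa [cylMap_extChartAt_self p₀ hF]) v
  have hid : mfderivWithin 𝓘(ℝ, Euc 1 × Euc n) (cylModel n)
      (extChartAt (cylModel n) p₀).symm (range (cylModel n))
      (extChartAt (cylModel n) p₀ p₀) = ContinuousLinearMap.id ℝ _ :=
    mfderivWithin_range_extChartAt_symm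
  refine h.trans ?_
  have hp : ∀ p, p = p₀ → ∀ m, m = loopMap hF p₀ (Circle.exp θ) → ∀ w : Euc 1 × Euc n, w = v →
      (mfderiv (𝓡 n) 𝓘(ℝ, Euc n) (extChartAt (𝓡 n) c) m
        (mfderiv (cylModel n) (𝓡 n) (fun p => loopMap hF p (Circle.exp θ)) p w : Euc n) : Euc n) =
      mfderiv (𝓡 n) 𝓘(ℝ, Euc n) (extChartAt (𝓡 n) c) (loopMap hF p₀ (Circle.exp θ))
        (mfderiv (cylModel n) (𝓡 n) (fun p => loopMap hF p (Circle.exp θ)) p₀ v) := by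
    rintro _ rfl _ rfl _ rfl
    rfl
  exact hp _ (extChartAt_to_inv (I := cylModel n) p₀) _ (cylMap_extChartAt_self p₀ hF θ) _
    (congrArg (fun L : Euc 1 × Euc n →L[ℝ] Euc 1 × Euc n => L v) hid)

theorem injective_mfderiv_of_isometry (g : RiemMetric n M) {f : M → M}
    (hiso : ∀ (m : M) (u v : TangentSpace (𝓡 n) m),
      g.inner (f m) (mfderiv (𝓡 n) (𝓡 n) f m u) (mfderiv (𝓡 n) (𝓡 n) f m v) = g.inner m u v)
    (m : M) : Function.Injective (mfderiv (𝓡 n) (𝓡 n) f m) := by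
  refine (injective_iff_map_eq_zero _).2 fun u hu => ?_
  by_contra hne
  have h := g.pos m u hne
  rw [← hiso, hu] at h
  simp at h

theorem cylCoord_fderivWithin_slice_self (hF : IsSmoothHomotopy n F) {c : M} {θ : ℝ}
    (hc : loopMap hF p₀ (Circle.exp θ) ∈ (extChartAt (𝓡 n) c).source) (a : Euc n) :
    fderivWithin ℝ (cylCoord F p₀ c) ((extChartAt (cylModel n) p₀).target ×ˢ univ)
      (extChartAt (cylModel n) p₀ p₀, θ) ((0, a), 0) =
      mfderiv (𝓡 n) 𝓘(ℝ, Euc n) (extChartAt (𝓡 n) c) (loopMap hF p₀ (Circle.exp θ))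
        (mfderiv (𝓡 n) (𝓡 n) (fun m => F (p₀.1, Circle.exp θ, m)) p₀.2 a) :=
  (cylCoord_fderivWithin_inl_self p₀ hF hc (0, a)).trans
    (congrArg (fun w : Euc n => (mfderiv (𝓡 n) 𝓘(ℝ, Euc n) (extChartAt (𝓡 n) c)
      (loopMap hF p₀ (Circle.exp θ)) w : Euc n)) (mfderiv_loopMap_zero p₀ hF (Circle.exp θ) a))

theorem injective_cylCoord_fderivWithin_slice_self (g : RiemMetric n M) (hF : IsSmoothHomotopy n F)
    {c : M} {θ : ℝ} (hc : loopMap hF p₀ (Circle.exp θ) ∈ (extChartAt (𝓡 n) c).source)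
    (hiso : IsRiemannianIsometry g (fun m => F (p₀.1, Circle.exp θ, m))) :
    Function.Injective fun a : Euc n => fderivWithin ℝ (cylCoord F p₀ c)
      ((extChartAt (cylModel n) p₀).target ×ˢ univ)
      (extChartAt (cylModel n) p₀ p₀, θ) ((0, a), 0) := by
  intro a a' haa
  have : IsManifold (𝓡 n) 1 M := IsManifold.of_le (n := ∞) ENat.LEInfty.out
  refine injective_mfderiv_of_isometry g hiso.2 p₀.2
    ((isInvertible_mfderiv_extChartAt hc).injective ?_)
  exact ((cylCoord_fderivWithin_slice_self p₀ hF hc a).symm.trans haa).trans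
    (cylCoord_fderivWithin_slice_self p₀ hF hc a')

end Basepoint

/-! ### Vanishing criteria for exterior derivatives and top-degree forms -/

section Forms

open Filter Topology Set

/-- The exterior derivative evaluated on `v` is a fixed continuous linear functional of the
derivative, so it passes under the integral, and the fundamental theorem of calculus leaves `φ b - φ
a`. -/
theorem extDerivWithin_intervalIntegral_apply_eq_zero {P : Type*} [NormedAddCommGroup P]
    [NormedSpace ℝ P] {s : Set P} {a b : ℝ} (hs : UniqueDiffOn ℝ s)
    (hconv : ∀ x ∈ s, ∃ ε > 0, Convex ℝ (s ∩ Metric.ball x ε)) {d : ℕ}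
    {f : P × ℝ → P [⋀^Fin d]→L[ℝ] ℝ} (hf : ContDiffOn ℝ ∞ f (s ×ˢ univ)) {x : P} (hx : x ∈ s)
    {v : Fin (d + 1) → P} {φ : ℝ → ℝ}
    (hφ : ∀ θ, HasDerivAt φ (extDerivWithin (fun z => f (z, θ)) s x v) θ) (hab : φ b = φ a) :
    extDerivWithin (fun z => ∫ θ in a..b, f (z, θ)) s x v = 0 := by
  rw [extDerivWithin, (fderivWithin_intervalIntegral hs hconv hf hx).fderivWithin (hs x hx)]
  have hcont := continuous_section_of_continuousOn
    (ContDiffOn.fderivWithin_comp_inl hs hf).continuousOn hx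
  let Λ : (P →L[ℝ] P [⋀^Fin d]→L[ℝ] ℝ) →L[ℝ] ℝ :=
    (ContinuousAlternatingMap.apply ℝ P ℝ v).comp
      (ContinuousAlternatingMap.alternatizeUncurryFinCLM ℝ P ℝ)
  have hΛ := Λ.intervalIntegral_comp_comm (hcont.intervalIntegrable
    (μ := MeasureTheory.volume) a b)
  refine hΛ.symm.trans ?_
  have hderiv : ∀ θ, HasDerivAt φ (Λ ((fderivWithin ℝ f (s ×ˢ univ) (x, θ)).comp
      (ContinuousLinearMap.inl ℝ P ℝ))) θ := by
    intro θ
    have h1 := hφ θ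
    rw [extDerivWithin, fderivWithin_section (hs x hx)
      (hf.differentiableOn (by simp) _ ⟨hx, mem_univ θ⟩)] at h1
    exact h1
  rw [intervalIntegral.integral_eq_sub_of_hasDerivAt (fun θ _ => hderiv θ)
    ((Λ.continuous.comp hcont).intervalIntegrable _ _), hab, sub_self]

/-- A top-degree form is a multiple of the determinant of any basis, and the product basis with the
`Euc 1` vector in front has the shape covered by the hypothesis. -/
theorem alternating_eq_zero_of_cons {n : ℕ} (η : (Euc 1 × Euc n) [⋀^Fin (n + 1)]→L[ℝ] ℝ)
    (h : ∀ (b : Euc 1) (e : Fin n → Euc n), η (Fin.cons (b, 0) fun i => (0, e i)) = 0) : η = 0 := by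
  let ε : Fin 1 ⊕ Fin n ≃ Fin (n + 1) := finSumFinEquiv.trans (finCongr (add_comm 1 n))
  let β := ((EuclideanSpace.basisFun (Fin 1) ℝ).toBasis.prod
    (EuclideanSpace.basisFun (Fin n) ℝ).toBasis).reindex ε
  have hβ : (β : Fin (n + 1) → Euc 1 × Euc n) =
      Fin.cons (EuclideanSpace.basisFun (Fin 1) ℝ 0, 0)
        (fun i => (0, EuclideanSpace.basisFun (Fin n) ℝ i)) := by
    ext1 i
    refine Fin.cases ?_ (fun j => ?_) i
    · have : ε.symm 0 = Sum.inl 0 := by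
        rw [Equiv.symm_apply_eq]
        rfl
      simp [β, this]
    · have : ε.symm j.succ = Sum.inr j := by
        rw [Equiv.symm_apply_eq]
        ext
        simp [ε]
      simp [β, this]
  have h0 : η.toAlternatingMap β = 0 := by
    rw [hβ]
    exact h _ _
  have h1 := η.toAlternatingMap.eq_smul_basis_det β
  rw [h0, zero_smul] at h1
  ext v
  exact congrArg (fun f => f v) h1

end Forms

/-! ### Closedness of the pulled-back form -/

section Closed

open Filter Topology Set

variable {k : ℕ} [NeZero k] {M : Type*} [TopologicalSpace M] [ChartedSpace (Euc (2 * k - 1)) M]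
  [IsManifold (𝓡 (2 * k - 1)) ∞ M] (g : RiemMetric (2 * k - 1) M)
  {F : unitInterval × Circle × M → M} (hF : IsSmoothHomotopy (2 * k - 1) F)
  (p₀ : unitInterval × M)

/-- The tensor `K` evaluated on `∂F/∂x⁰, ∂F/∂x¹, …, ∂F/∂x^{2k-1}` along a loop. -/
noncomputable def homotopyDensity (b : Euc 1) (e : Fin (2 * k - 1) → Euc (2 * k - 1)) (θ : ℝ) : ℝ :=
  let L : Euc 1 × Euc (2 * k - 1) →L[ℝ] Euc (2 * k - 1) :=
    mfderiv (cylModel (2 * k - 1)) (𝓡 (2 * k - 1)) (fun q => loopMap hF q (Circle.exp θ)) p₀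
  kTensor g (loopMap hF p₀ (Circle.exp θ)) (L (b, 0)) (fun i => L (0, e i))

/-- The density depends on θ only through `Circle.exp θ`, so the boundary terms of the integral over
a period agree. -/
theorem homotopyDensity_two_pi (b : Euc 1) (e : Fin (2 * k - 1) → Euc (2 * k - 1)) :
    homotopyDensity g hF p₀ b e (2 * Real.pi) = homotopyDensity g hF p₀ b e 0 := by
  have h : ∀ z z' : Circle, z = z' →
      kTensor g (loopMap hF p₀ z)
        (mfderiv (cylModel (2 * k - 1)) (𝓡 (2 * k - 1)) (fun q => loopMap hF q z) p₀ (b, 0))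
        (fun i => mfderiv (cylModel (2 * k - 1)) (𝓡 (2 * k - 1)) (fun q => loopMap hF q z) p₀
          (0, e i)) =
      kTensor g (loopMap hF p₀ z')
        (mfderiv (cylModel (2 * k - 1)) (𝓡 (2 * k - 1)) (fun q => loopMap hF q z') p₀ (b, 0))
        (fun i => mfderiv (cylModel (2 * k - 1)) (𝓡 (2 * k - 1)) (fun q => loopMap hF q z') p₀
          (0, e i)) := by
    rintro _ _ rfl
    rfl
  exact h _ _ (Circle.exp_two_pi.trans Circle.exp_zero.symm)

theorem homotopyDensity_eq_curvForm {c : M} {θ : ℝ}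
    (hc : loopMap hF p₀ (Circle.exp θ) ∈ (extChartAt (𝓡 (2 * k - 1)) c).source)
    (b : Euc 1) (e : Fin (2 * k - 1) → Euc (2 * k - 1)) :
    homotopyDensity g hF p₀ b e θ =
      curvForm k (chartCurv (metricInChart g c)
          (cylCoord F p₀ c (extChartAt (cylModel (2 * k - 1)) p₀ p₀, θ)))
        (fderivWithin ℝ (cylCoord F p₀ c)
          ((extChartAt (cylModel (2 * k - 1)) p₀).target ×ˢ univ)
          (extChartAt (cylModel (2 * k - 1)) p₀ p₀, θ) ((b, 0), 0))
        (fun i => fderivWithin ℝ (cylCoord F p₀ c)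
          ((extChartAt (cylModel (2 * k - 1)) p₀).target ×ˢ univ)
          (extChartAt (cylModel (2 * k - 1)) p₀ p₀, θ) ((0, e i), 0)) := by
  have h0 : homotopyDensity g hF p₀ b e θ = _ :=
    kTensor_eq_curvSum_of_mem_source g (loopMap hF p₀ (Circle.exp θ)) c hc
      (mfderiv (cylModel (2 * k - 1)) (𝓡 (2 * k - 1)) (fun q => loopMap hF q (Circle.exp θ)) p₀
        ((b, 0) : Euc 1 × Euc (2 * k - 1)))
      (fun i => mfderiv (cylModel (2 * k - 1)) (𝓡 (2 * k - 1))
        (fun q => loopMap hF q (Circle.exp θ)) p₀ ((0, e i) : Euc 1 × Euc (2 * k - 1)))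
  have h1 := cylCoord_fderivWithin_inl_self p₀ hF hc
  rw [h0, curvForm_apply, h1 (b, 0), cylCoord, cylMap_extChartAt_self p₀ hF]
  exact congrArg (curvSum k _ _) (funext fun i => (h1 (0, e i)).symm)

/-- Supplies the invariance hypothesis of `hasDerivAt_transgression`: K at the moving point is
carried back along the isometric slice to K at `p₀.2`, which is independent of θ. -/
theorem curvForm_slice_self (c : M) {θ : ℝ}
    (hc : loopMap hF p₀ (Circle.exp θ) ∈ (extChartAt (𝓡 (2 * k - 1)) c).source)
    (hiso : IsRiemannianIsometry g (fun m => F (p₀.1, Circle.exp θ, m)))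
    (a : Euc (2 * k - 1)) (e : Fin (2 * k - 1) → Euc (2 * k - 1)) :
    curvForm k (chartCurv (metricInChart g c)
          (cylCoord F p₀ c (extChartAt (cylModel (2 * k - 1)) p₀ p₀, θ)))
        (fderivWithin ℝ (cylCoord F p₀ c)
          ((extChartAt (cylModel (2 * k - 1)) p₀).target ×ˢ univ)
          (extChartAt (cylModel (2 * k - 1)) p₀ p₀, θ) ((0, a), 0))
        (fun i => fderivWithin ℝ (cylCoord F p₀ c)
          ((extChartAt (cylModel (2 * k - 1)) p₀).target ×ˢ univ)
          (extChartAt (cylModel (2 * k - 1)) p₀ p₀, θ) ((0, e i), 0)) =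
      curvForm k (curvAt g p₀.2) a e := by
  have h1 := kTensor_eq_curvSum_chart g (contMDiff_slice hF p₀.1 (Circle.exp θ))
    hiso.2 p₀.2 c hc a e
  have h2 := cylCoord_fderivWithin_slice_self p₀ hF hc
  refine (curvForm_apply _ _ _).trans (Eq.trans ?_ (h1.symm.trans
    ((kTensor_eq_curvSum g p₀.2 a e).trans (curvForm_apply _ _ _).symm)))
  rw [h2, cylCoord, cylMap_extChartAt_self p₀ hF]
  exact congrArg (curvSum k _ _) (funext fun i => h2 (e i))

theorem chartForm_eventuallyEq_coordForm (θ₀ : ℝ) :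
    (fun z => chartForm g hF p₀ (z, θ₀)) =ᶠ[𝓝[(extChartAt (cylModel (2 * k - 1)) p₀).target]
        (extChartAt (cylModel (2 * k - 1)) p₀ p₀)]
      fun z => coordForm g F p₀ (loopMap hF p₀ (Circle.exp θ₀)) (z, θ₀) := by
  have h1 := eventually_section (eventually_cylMap_mem_source p₀ hF
    (q := (extChartAt (cylModel (2 * k - 1)) p₀ p₀, θ₀))
    ⟨mem_extChartAt_target (I := cylModel (2 * k - 1)) p₀, mem_univ _⟩)
  rw [cylMap_extChartAt_self p₀ hF] at h1
  filter_upwards [h1, self_mem_nhdsWithin] with z hz hzT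
  exact chartForm_eq g hF p₀ ⟨hzT, mem_univ _⟩ hz

/-- A single chart of M around the loop at θ₀ contains the loop for nearby θ, which is all that a
derivative at θ₀ requires. -/
theorem hasDerivAt_homotopyDensity
    (hiso : ∀ (t : unitInterval) (z : Circle), IsRiemannianIsometry g (fun m => F (t, z, m)))
    (b : Euc 1) (e : Fin (2 * k - 1) → Euc (2 * k - 1)) (θ₀ : ℝ) :
    HasDerivAt (homotopyDensity g hF p₀ b e)
      (extDerivWithin (fun x => chartForm g hF p₀ (x, θ₀))
        (extChartAt (cylModel (2 * k - 1)) p₀).target (extChartAt (cylModel (2 * k - 1)) p₀ p₀)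
        (Fin.cons (b, 0) (fun i => (0, e i)))) θ₀ := by
  have hxT : extChartAt (cylModel (2 * k - 1)) p₀ p₀ ∈
    (extChartAt (cylModel (2 * k - 1)) p₀).target := mem_extChartAt_target p₀
  have hev := eventually_loopMap_mem_source p₀ hF θ₀
  have hcs := hev.self_of_nhds
  have hcs' : cylMap F p₀ (extChartAt (cylModel (2 * k - 1)) p₀ p₀, θ₀) ∈
      (extChartAt (𝓡 (2 * k - 1)) (loopMap hF p₀ (Circle.exp θ₀))).source := by
    rwa [cylMap_extChartAt_self p₀ hF]
  rw [(chartForm_eventuallyEq_coordForm g hF p₀ θ₀).extDerivWithin_eq_of_mem hxT]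
  have hκ : DifferentiableAt ℝ
      (fun y => curvForm k (chartCurv (metricInChart g (loopMap hF p₀ (Circle.exp θ₀))) y))
      (cylCoord F p₀ (loopMap hF p₀ (Circle.exp θ₀))
        (extChartAt (cylModel (2 * k - 1)) p₀ p₀, θ₀)) :=
    (contDiffAt_curvForm_chartCurv g _
      ((extChartAt (𝓡 (2 * k - 1)) _).map_source hcs')).differentiableAt (by simp)
  refine (hasDerivAt_transgression (n := 2 * k - 1) (by simp) (uniqueDiffOn_cyl_target p₀)
    (extChartAt_target_subset_closure_interior hxT) hxT
    (contDiffWithinAt_cylCoord p₀ hF ⟨hxT, mem_univ _⟩ hcs') hκ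
    (injective_cylCoord_fderivWithin_slice_self p₀ g hF hcs (hiso _ _))
    (κ₀ := curvForm k (curvAt g p₀.2)) (hev.mono fun θ hθ a e =>
      curvForm_slice_self g hF p₀ _ hθ (hiso _ _) a e) b e).congr_of_eventuallyEq
        (hev.mono fun θ hθ => homotopyDensity_eq_curvForm g hF p₀ hθ b e)

theorem exteriorDerivative_pullbackForm
    (hiso : ∀ (t : unitInterval) (z : Circle), IsRiemannianIsometry g (fun m => F (t, z, m))) :
    exteriorDerivative (cylModel (2 * k - 1)) (pullbackForm g hF) p₀ = 0 := by
  set T := (extChartAt (cylModel (2 * k - 1)) p₀).target with hT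
  set x := extChartAt (cylModel (2 * k - 1)) p₀ p₀ with hx
  have hxT : x ∈ T := mem_extChartAt_target p₀
  have hTu : UniqueDiffOn ℝ T := uniqueDiffOn_cyl_target p₀
  have hsm := contDiffOn_chartForm g hF p₀
  -- The exterior derivative is defined relative to the range of the model, and the integral lemmas
  -- work on the chart target; the two sets agree near `x`.
  have hTS : T =ᶠ[𝓝 x] range (cylModel (2 * k - 1)) := by
    have h1 := mem_nhdsWithin_iff_eventually.1 (extChartAt_target_mem_nhdsWithin_of_mem hxT)
    filter_upwards [h1] with z hz
    exact propext ⟨fun h => extChartAt_target_subset_range p₀ h, hz⟩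
  have hzero : extDerivWithin (formInChart (cylModel (2 * k - 1)) (pullbackForm g hF) p₀)
      (range (cylModel (2 * k - 1))) x = 0 := by
    refine alternating_eq_zero_of_cons _ fun b e => ?_
    have hint : formInChart (cylModel (2 * k - 1)) (pullbackForm g hF) p₀ =
        fun z => ∫ θ in (0 : ℝ)..(2 * Real.pi), chartForm g hF p₀ (z, θ) :=
      funext fun z => formInChart_pullbackForm g hF p₀ z
    have hcs : extDerivWithin (fun z => ∫ θ in (0 : ℝ)..(2 * Real.pi), chartForm g hF p₀ (z, θ))
        (range (cylModel (2 * k - 1))) x =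
        extDerivWithin (fun z => ∫ θ in (0 : ℝ)..(2 * Real.pi), chartForm g hF p₀ (z, θ)) T x := by
      rw [extDerivWithin, extDerivWithin, fderivWithin_congr_set hTS]
    rw [hint, hcs]
    exact extDerivWithin_intervalIntegral_apply_eq_zero hTu
      (fun z hz => exists_convex_cyl_target p₀ hz) hsm hxT
      (hasDerivAt_homotopyDensity g hF p₀ hiso b e) (homotopyDensity_two_pi g hF p₀ b e)
  ext v
  exact congrArg (fun A : (Euc 1 × Euc (2 * k - 1)) [⋀^Fin (2 * k - 1 + 1)]→L[ℝ] ℝ =>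
    A (mfderiv (cylModel (2 * k - 1)) 𝓘(ℝ, Euc 1 × Euc (2 * k - 1))
      (extChartAt (cylModel (2 * k - 1)) p₀) p₀ ∘ v)) hzero

end Closed
end LoopCS

theorem mainTheorem1 (k : ℕ) [NeZero k] {M : Type*} [TopologicalSpace M] [T2Space M]
    [CompactSpace M] [ChartedSpace (LoopCS.Euc (2 * k - 1)) M]
    [IsManifold (𝓡 (2 * k - 1)) ∞ M] (g : LoopCS.RiemMetric (2 * k - 1) M)
    (a₀ a₁ : Circle → M → M)
    (ha₀ : LoopCS.IsIsometricCircleAction g a₀) (ha₁ : LoopCS.IsIsometricCircleAction g a₁)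
    (F : unitInterval × Circle × M → M) (hF : LoopCS.IsSmoothHomotopy (2 * k - 1) F)
    (hF₀ : ∀ θ m, F (0, θ, m) = a₀ θ m) (hF₁ : ∀ θ m, F (1, θ, m) = a₁ θ m)
    (hFisom : ∀ (t : unitInterval) (θ : Circle),
      LoopCS.IsRiemannianIsometry g (fun m => F (t, θ, m))) :
    ∃ η : ∀ p : unitInterval × M,
        TangentSpace (LoopCS.cylModel (2 * k - 1)) p [⋀^Fin (2 * k - 1)]→L[ℝ] ℝ,
      (∀ (p : unitInterval × M)
          (V : Fin (2 * k - 1) → TangentSpace (LoopCS.cylModel (2 * k - 1)) p),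
        η p V = LoopCS.wodzickiCS g (LoopCS.loopMap hF p)
          (fun i => LoopCS.loopMapDeriv hF p (V i))) ∧
      LoopCS.IsSmoothForm (LoopCS.cylModel (2 * k - 1)) η ∧
      ∀ p, LoopCS.exteriorDerivative (LoopCS.cylModel (2 * k - 1)) η p = 0 :=
  ⟨LoopCS.pullbackForm g hF, LoopCS.pullbackForm_apply g hF, LoopCS.isSmoothForm_pullbackForm g hF,
    fun p => LoopCS.exteriorDerivative_pullbackForm g hF p hFisom⟩
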